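/- Let $\mathcal C$ be a non-degenerately braided fusion category over $\mathbb C$ with braiding $\beta$ (every simple object $x$ with $\beta_{y,x}\circ\beta_{x,y}=\mathrm{id}_{x\otimes y}$ for all $y$ is isomorphic to $1_{\mathcal C}$), and let $A\in\mathcal C$ be a connected étale algebra, i.e. a commutative separable algebra with $\dim\mathcal C(1_{\mathcal C}\to A)=1$. Notation. $\mathrm{Inv}(\mathcal C)$ is the group of isomorphism classes of invertible objects under $\otimes$, and $A'\cap\mathrm{Inv}(\mathcal C)$ is its subgroup of those $a$ with $\beta_{A,a}\circ\beta_{a,A}=\mathrm{id}_{a\otimes A}$. $\mathrm{Aut}_{\mathcal C}(A)$ is the group of algebra automorphisms of $A$. $\underline{\mathsf{Aut}}^{\mathsf{br}}_\otimes(\mathcal C)$ is the categorical group (monoidal category of 1-morphisms under composition) of $\mathbb C$-linear braided tensor autoequivalences $(\alpha,\psi)$ of $\mathcal C$ and monoidal natural isomorphisms. $\underline{\mathsf{Aut}}^{\mathsf{br}}_\otimes(\mathcal C|A)$ is the categorical group of triples $(\alpha,\psi,\lambda)$ with $(\alpha,\psi)\in\underline{\mathsf{Aut}}^{\mathsf{br}}_\otimes(\mathcal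 C)$ and $\lambda:\alpha(A)\to A$ an algebra isomorphism, with composition $(\alpha,\lambda)\circ(\gamma,\kappa)=(\alpha\circ\gamma,\lambda\circ\alpha(\kappa))$, whose 2-morphisms $(\alpha,\psi,\lambda)\Rightarrow(\gamma,\varphi,\kappa)$ are the monoidal natural isomorphisms $\eta:\alpha\Rightarrow\gamma$ with $\kappa\circ\eta_A=\lambda$. $\underline{\mathrm{Stab}}^{\mathsf{br}}_\otimes(A)\subset\underline{\mathsf{Aut}}^{\mathsf{br}}_\otimes(\mathcal C)$ is the full categorical subgroup of those $\alpha$ with $\alpha(A)\cong A$ as algebras. Removing the underline denotes the truncation $\pi_1$ (the group of isomorphism classes of 1-morphisms), and $\pi_2$ denotes the group of automorphisms of the identity 1-morphism. For $a\in\mathrm{Inv}(\mathcal C)$, the ring operator $\sigma^a\in\pi_2(\underline{\mathsf{Aut}}^{\mathsf{br}}_\otimes(\mathcal C))$ is the monoidal natural automorphism of $\mathrm{id}_{\mathcal C}$ determined by $\beta_{c,a}\circ\beta_{a,c}=\mathrm{id}_a\otimes\sigma^a_c$ for all $c\in\mathcal C$. Then: 1. $\sigma:\mathrm{Inv}(\mathcal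 C)\to\pi_2(\underline{\mathsf{Aut}}^{\mathsf{br}}_\otimes(\mathcal C))$, $a\mapsto\sigma^a$, is an isomorphism of groups, and it yields a group isomorphism $\pi_2(\underline{\mathsf{Aut}}^{\mathsf{br}}_\otimes(\mathcal C|A))\cong A'\cap\mathrm{Inv}(\mathcal C)$: there is a group isomorphism $e$ from the former to the latter such that $\sigma\circ e$ is the map on $\pi_2$ induced by forgetting $\lambda$. 2. The sequence of groups $$1\to A'\cap\mathrm{Inv}(\mathcal C)\hookrightarrow\mathrm{Inv}(\mathcal C)\xrightarrow{\ \sigma_A\ }\mathrm{Aut}_{\mathcal C}(A)\xrightarrow{\ [\mathrm{id}_{\mathcal C},\,\cdot\,]\ }\mathsf{Aut}^{\mathsf{br}}_\otimes(\mathcal C|A)\xrightarrow{\ F\ }\mathrm{Stab}^{\mathsf{br}}_\otimes(A)\to 1$$ is exact, where $\sigma_A(a)=\sigma^a_A$, the map $[\mathrm{id}_{\mathcal C},\,\cdot\,]$ sends $\lambda$ to the class of $(\mathrm{id}_{\mathcal C},\mathrm{id},\lambda)$, and $F$ is induced by the forgetful functor $(\alpha,\psi,\lambda)\mapsto(\alpha,\psi)$.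 -/

import Mathlib

open CategoryTheory MonoidalCategory
open scoped MonObj

universe v u

/-! ### Categorical groups, their truncation `π₁`, and `π₂` -/

namespace CatGrp

variable (G : Type u) [Category.{v} G] [MonoidalCategory G]

/-- A categorical group (a one-object 2-category whose 1-morphisms are invertible up to
2-morphisms and whose 2-morphisms are invertible), given as the monoidal category of its 1- and
2-morphisms: the tensor product is the composition of 1-morphisms. -/
class IsCategoricalGroup : Prop where
  isIso_hom : ∀ {X Y : G} (f : X ⟶ Y), IsIso f
  isUnit_obj : ∀ X : G, IsUnit (toSkeleton X)

/-- The truncation `π₁`: the isomorphism classes of 1-morphisms, with the multiplication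
induced by composition of 1-morphisms. -/
abbrev Pi1 : Type u := Skeleton G

noncomputable instance [IsCategoricalGroup G] : Group (Pi1 G) :=
  groupOfIsUnit fun a => by
    induction a using Quotient.inductionOn with
    | h X => exact IsCategoricalGroup.isUnit_obj X

theorem IsCategoricalGroup.of_leftInv (h₁ : ∀ {X Y : G} (f : X ⟶ Y), IsIso f)
    (h₂ : ∀ X : G, ∃ Y : G, Nonempty (Y ⊗ X ≅ 𝟙_ G)) : IsCategoricalGroup G where
  isIso_hom := h₁
  isUnit_obj X := by
    obtain ⟨Y, ⟨e⟩⟩ := h₂ X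
    obtain ⟨Z, ⟨f⟩⟩ := h₂ Y
    have hYX : toSkeleton Y * toSkeleton X = 1 := by
      rw [← Skeleton.toSkeleton_tensorObj, Skeleton.one_eq]; exact congr_toSkeleton_of_iso e
    have hZY : toSkeleton Z * toSkeleton Y = 1 := by
      rw [← Skeleton.toSkeleton_tensorObj, Skeleton.one_eq]; exact congr_toSkeleton_of_iso f
    exact ⟨⟨toSkeleton X, toSkeleton Y, left_inv_eq_right_inv hZY hYX ▸ hZY, hYX⟩, rfl⟩

/-- `π₂`: the automorphisms of the identity 1-morphism. -/
abbrev Pi2 : Type v := Aut (𝟙_ G)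

variable {G}
variable {H : Type*} [Category* H] [MonoidalCategory H]

/-- The map on truncations induced by a monoidal functor. -/
noncomputable def Pi1.map (F : G ⥤ H) [F.Monoidal] : Pi1 G →* Pi1 H :=
  Skeleton.monoidHom F

theorem Pi1.map_toSkeleton (F : G ⥤ H) [F.Monoidal] (X : G) :
    Pi1.map F (toSkeleton X) = toSkeleton (F.obj X) :=
  F.mapSkeleton_obj_toSkeleton X

/-- The map on `π₂` induced by a monoidal functor. -/
def Pi2.map (F : G ⥤ H) [F.Monoidal] : Pi2 G →* Pi2 H :=
  (Functor.Monoidal.εIso F).symm.conjAut.toMonoidHom.comp (F.mapAut (𝟙_ G))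

end CatGrp

open CatGrp

/-! ### Braided fusion categories -/

section Fusion

attribute [local instance] Abelian.hasFiniteBiproducts

/-- A fusion category over `ℂ`: a `ℂ`-linear abelian rigid monoidal category with bilinear tensor
product and finite-dimensional morphism spaces that is semisimple with finitely many
isomorphism classes of simple objects and whose unit object is simple. -/
class IsFusionCategory (C : Type u) [Category.{v} C] [Abelian C] [Linear ℂ C] [MonoidalCategory C]
    [MonoidalPreadditive C] [MonoidalLinear ℂ C] [RigidCategory C] : Prop where
  finiteDimensional_hom : ∀ X Y : C, FiniteDimensional ℂ (X ⟶ Y)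
  semisimple : ∀ X : C, ∃ (n : ℕ) (S : Fin n → C), (∀ i, Simple (S i)) ∧ Nonempty (X ≅ ⨁ S)
  finite_simples : ∃ (n : ℕ) (S : Fin n → C), ∀ X : C, Simple X → ∃ i, Nonempty (X ≅ S i)
  simple_unit : Simple (𝟙_ C)

variable {C : Type u} [Category.{v} C] [MonoidalCategory C] [BraidedCategory C]

/-- The double braiding `β_{c,a} ∘ β_{a,c}` on `a ⊗ c`. -/
def monodromy (a c : C) : a ⊗ c ⟶ a ⊗ c := (β_ a c).hom ≫ (β_ c a).hom

/-- `a` and `c` are transparent to each other (they centralize each other). -/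
def Transparent (a c : C) : Prop := monodromy a c = 𝟙 (a ⊗ c)

variable (C) in
/-- A non-degenerate braiding: the Müger center is trivial, i.e. the only simple object that is
transparent to every object is the unit. -/
class IsNondegenerate [Abelian C] : Prop where
  iso_unit : ∀ X : C, Simple X → (∀ Y : C, Transparent X Y) → Nonempty (X ≅ 𝟙_ C)

/-- A connected étale algebra: commutative, separable (the multiplication is split by a map of
bimodules), and with one-dimensional space of morphisms from the unit object. -/
class IsConnectedEtale [Abelian C] [Linear ℂ C] (A : Mon C) : Prop where
  commutative : (β_ A.X A.X).hom ≫ μ[A.X] = μ[A.X]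
  separable : ∃ s : A.X ⟶ A.X ⊗ A.X, s ≫ μ[A.X] = 𝟙 A.X ∧
    μ[A.X] ≫ s = A.X ◁ s ≫ (α_ A.X A.X A.X).inv ≫ μ[A.X] ▷ A.X ∧
    μ[A.X] ≫ s = s ▷ A.X ≫ (α_ A.X A.X A.X).hom ≫ A.X ◁ μ[A.X]
  connected : Module.finrank ℂ (𝟙_ C ⟶ A.X) = 1

end Fusion

/-! ### The categorical group of braided autoequivalences -/

/-- A braided tensor autoequivalence `(α, ψ)` (with `α` linear). -/
structure BrAut (C : Type u) [Category.{v} C] [Abelian C] [Linear ℂ C] [MonoidalCategory C]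
    [BraidedCategory C] where
  functor : C ⥤ C
  [braided : functor.Braided]
  [additive : functor.Additive]
  [linear : functor.Linear ℂ]
  [isEquivalence : functor.IsEquivalence]

namespace BrAut

theorem inverse_isMonoidal {C D : Type*} [Category* C] [MonoidalCategory C]
    [Category* D] [MonoidalCategory D] (e : C ≌ D) [e.functor.Monoidal] :
    letI := e.inverseMonoidal
    e.IsMonoidal := by
  let := e.toAdjunction.rightAdjointLaxMonoidal
  have h : e.toAdjunction.IsMonoidal := inferInstance
  exact h

theorem inverse_braided {C D : Type*} [Category* C] [MonoidalCategory C] [BraidedCategory C]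
    [Category* D] [MonoidalCategory D] [BraidedCategory D]
    (e : C ≌ D) [e.functor.Braided] [e.inverse.Monoidal] [e.IsMonoidal] (X Y : D) :
    Functor.LaxMonoidal.μ e.inverse X Y ≫ e.inverse.map (β_ X Y).hom =
      (β_ (e.inverse.obj X) (e.inverse.obj Y)).hom ≫ Functor.LaxMonoidal.μ e.inverse Y X := by
  apply e.functor.map_injective
  rw [← cancel_mono (e.counitIso.hom.app (Y ⊗ X))]
  have h := e.counitIso.hom.naturality (β_ X Y).hom
  dsimp only [Functor.comp_map, Functor.id_map, Functor.comp_obj, Functor.id_obj] at h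
  rw [Functor.map_comp, Functor.map_comp, Category.assoc, Category.assoc, h,
    e.functor_map_μ_inverse_comp_counitIso_hom_app_tensor_assoc,
    e.functor_map_μ_inverse_comp_counitIso_hom_app_tensor, Functor.map_braiding]
  simp

attribute [instance] braided additive linear isEquivalence

variable {C : Type u} [Category.{v} C] [Abelian C] [Linear ℂ C] [MonoidalCategory C]
  [BraidedCategory C]

/-- 2-morphisms: monoidal natural isomorphisms. -/
@[ext]
structure Hom (F G : BrAut C) where
  iso : F.functor ≅ G.functor
  isMonoidal : NatTrans.IsMonoidal iso.hom := by infer_instance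

attribute [instance] Hom.isMonoidal

instance : Category (BrAut C) where
  Hom := Hom
  id F := ⟨Iso.refl F.functor, inferInstanceAs (NatTrans.IsMonoidal (𝟙 _))⟩
  comp f g := ⟨f.iso ≪≫ g.iso, inferInstanceAs (NatTrans.IsMonoidal (f.iso.hom ≫ g.iso.hom))⟩

@[ext]
theorem hom_ext {F G : BrAut C} {f g : F ⟶ G}
    (h : ∀ X : C, f.iso.hom.app X = g.iso.hom.app X) : f = g :=
  Hom.ext (Iso.ext (NatTrans.ext (funext h)))

@[simp] theorem id_app (F : BrAut C) (X : C) :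
    (Hom.iso (𝟙 F)).hom.app X = 𝟙 (F.functor.obj X) := rfl

@[simp] theorem comp_app {F G H : BrAut C} (f : F ⟶ G) (g : G ⟶ H) (X : C) :
    (f ≫ g).iso.hom.app X = f.iso.hom.app X ≫ g.iso.hom.app X := rfl

/-- The inverse 2-morphism. -/
def homSymm {F G : BrAut C} (f : F ⟶ G) : G ⟶ F :=
  Hom.mk f.iso.symm (inferInstanceAs (NatTrans.IsMonoidal f.iso.inv))

/-- An isomorphism in the category of 1-morphisms from a 2-morphism. -/
@[simps]
def isoOfHom {F G : BrAut C} (f : F ⟶ G) : F ≅ G where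
  hom := f
  inv := homSymm f
  hom_inv_id := by ext X; exact f.iso.hom_inv_id_app X
  inv_hom_id := by ext X; exact f.iso.inv_hom_id_app X

/-- The tensor product `F ⊗ G` is the composite `F ∘ G` (first `G`, then `F`). -/
instance : MonoidalCategoryStruct (BrAut C) where
  tensorObj F G := ⟨G.functor ⋙ F.functor⟩
  tensorUnit := ⟨𝟭 C⟩
  whiskerLeft F _ _ g := Hom.mk (Functor.isoWhiskerRight g.iso F.functor)
    (inferInstanceAs (NatTrans.IsMonoidal (Functor.whiskerRight g.iso.hom F.functor)))
  whiskerRight f G := Hom.mk (Functor.isoWhiskerLeft G.functor f.iso)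
    (inferInstanceAs (NatTrans.IsMonoidal (Functor.whiskerLeft G.functor f.iso.hom)))
  associator F G H := isoOfHom (Hom.mk (Functor.associator H.functor G.functor F.functor).symm
    (inferInstanceAs (NatTrans.IsMonoidal
      (Functor.associator H.functor G.functor F.functor).inv)))
  leftUnitor F := isoOfHom (Hom.mk F.functor.rightUnitor inferInstance)
  rightUnitor F := isoOfHom (Hom.mk F.functor.leftUnitor inferInstance)

@[simp] theorem tensorObj_functor (F G : BrAut C) : (F ⊗ G).functor = G.functor ⋙ F.functor := rfl

@[simp] theorem tensorUnit_functor : (𝟙_ (BrAut C)).functor = 𝟭 C := rfl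

@[simp] theorem whiskerLeft_app (F : BrAut C) {G H : BrAut C} (g : G ⟶ H) (X : C) :
    (F ◁ g).iso.hom.app X = F.functor.map (g.iso.hom.app X) := rfl

@[simp] theorem whiskerRight_app {F G : BrAut C} (f : F ⟶ G) (H : BrAut C) (X : C) :
    (f ▷ H).iso.hom.app X = f.iso.hom.app (H.functor.obj X) := rfl

theorem tensorHom_eq {F G H K : BrAut C} (f : F ⟶ G) (g : H ⟶ K) :
    f ⊗ₘ g = f ▷ H ≫ G ◁ g := rfl

@[simp] theorem associator_hom_app (F G H : BrAut C) (X : C) :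
    (α_ F G H).hom.iso.hom.app X = 𝟙 (F.functor.obj (G.functor.obj (H.functor.obj X))) := rfl

@[simp] theorem leftUnitor_hom_app (F : BrAut C) (X : C) :
    (λ_ F).hom.iso.hom.app X = 𝟙 (F.functor.obj X) := rfl

@[simp] theorem rightUnitor_hom_app (F : BrAut C) (X : C) :
    (ρ_ F).hom.iso.hom.app X = 𝟙 (F.functor.obj X) := rfl

instance : MonoidalCategory (BrAut C) :=
  MonoidalCategory.ofTensorHom
    (id_tensorHom_id := fun F G => by ext X; simp [tensorHom_eq])
    (tensorHom_comp_tensorHom := fun f₁ f₂ g₁ g₂ => by ext X; simp [tensorHom_eq])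
    (id_tensorHom := fun F _ _ g => by ext X; simp [tensorHom_eq])
    (tensorHom_id := fun f G => by ext X; simp [tensorHom_eq])
    (associator_naturality := fun f g h => by ext X; simp [tensorHom_eq])
    (leftUnitor_naturality := fun f => by ext X; simp [tensorHom_eq])
    (rightUnitor_naturality := fun f => by ext X; simp [tensorHom_eq])
    (pentagon := fun F G H K => by ext X; simp [tensorHom_eq])
    (triangle := fun F G => by ext X; simp [tensorHom_eq])

/-- The inverse functor, with its inverse monoidal structure. -/
noncomputable def inverse (F : BrAut C) : BrAut C :=
  letI e := F.functor.asEquivalence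
  letI : e.functor.Braided := F.braided
  letI : e.inverse.Monoidal := e.inverseMonoidal
  haveI : e.IsMonoidal := inverse_isMonoidal e
  letI : e.functor.Additive := F.additive
  letI : e.functor.Linear ℂ := F.linear
  letI : e.inverse.Braided := { braided := inverse_braided e }
  ⟨e.inverse⟩

/-- `F⁻¹ ∘ F` is isomorphic to the identity. -/
noncomputable def inverseTensorIso (F : BrAut C) : F.inverse ⊗ F ≅ 𝟙_ (BrAut C) :=
  letI e := F.functor.asEquivalence
  letI : e.functor.Braided := F.braided
  letI : e.inverse.Monoidal := e.inverseMonoidal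
  haveI : e.IsMonoidal := inverse_isMonoidal e
  haveI : NatTrans.IsMonoidal e.unitIso.hom := inferInstanceAs (NatTrans.IsMonoidal e.unit)
  isoOfHom (Hom.mk e.unitIso.symm
    (inferInstanceAs (NatTrans.IsMonoidal e.unitIso.inv)))

instance : IsCategoricalGroup (BrAut C) :=
  .of_leftInv _ (fun f => (isoOfHom f).isIso_hom) fun F => ⟨F.inverse, ⟨F.inverseTensorIso⟩⟩

end BrAut

/-! ### Automorphisms together with an algebra isomorphism, and stabilizers -/

section Over

variable {C : Type u} [Category.{v} C] [Abelian C] [Linear ℂ C] [MonoidalCategory C]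
  [BraidedCategory C]

/-- Triples `(α, ψ, λ)`: a braided autoequivalence `(α, ψ)` with an algebra isomorphism
`λ : α(A) → A`, where `α(A)` has multiplication `α(m) ∘ ψ` and unit `α(i)`. -/
structure BrAutOver (A : Mon C) where
  aut : BrAut C
  algIso : aut.functor.mapMon.obj A ≅ A

namespace BrAutOver

variable {A : Mon C}

/-- The underlying morphism of the algebra isomorphism. -/
def lam (F : BrAutOver A) : F.aut.functor.obj A.X ⟶ A.X := F.algIso.hom.hom

/-- 2-morphisms `(α, ψ, λ) ⇒ (γ, φ, κ)`: monoidal natural isomorphisms `η` with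
`κ ∘ η_A = λ`. -/
@[ext]
structure Hom (F G : BrAutOver A) where
  toHom : F.aut ⟶ G.aut
  comm : toHom.iso.hom.app A.X ≫ G.lam = F.lam

instance : Category (BrAutOver A) where
  Hom := Hom
  id F := ⟨𝟙 F.aut, by simp⟩
  comp f g := ⟨f.toHom ≫ g.toHom, by simp [Hom.comm]⟩

/-- An isomorphism from a 2-morphism. -/
@[simps]
def isoOfHom {F G : BrAutOver A} (f : Hom F G) : F ≅ G where
  hom := f
  inv := Hom.mk (BrAut.homSymm f.toHom) (by
    rw [← f.comm]; exact f.toHom.iso.inv_hom_id_app_assoc _ _)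
  hom_inv_id := Hom.ext (BrAut.isoOfHom f.toHom).hom_inv_id
  inv_hom_id := Hom.ext (BrAut.isoOfHom f.toHom).inv_hom_id

/-- The composite `(α, λ) ∘ (γ, κ) = (α ∘ γ, λ ∘ α(κ))`. -/
def comp (F G : BrAutOver A) : BrAutOver A where
  aut := F.aut ⊗ G.aut
  algIso := Functor.mapMonCompIso.app A ≪≫ F.aut.functor.mapMon.mapIso G.algIso ≪≫ F.algIso

theorem comp_lam (F G : BrAutOver A) :
    (F.comp G).lam = F.aut.functor.map G.lam ≫ F.lam :=
  Category.id_comp _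

/-- The triple `(id, id, l)` for an algebra automorphism `l` of `A`. -/
def ofAut (l : Aut A) : BrAutOver A where
  aut := 𝟙_ (BrAut C)
  algIso := Functor.mapMonIdIso.app A ≪≫ l

theorem ofAut_lam (l : Aut A) : (ofAut l).lam = l.hom.hom :=
  Category.id_comp _

instance : MonoidalCategoryStruct (BrAutOver A) where
  tensorObj F G := F.comp G
  tensorUnit := ofAut 1
  whiskerLeft F _ _ g := Hom.mk (F.aut ◁ g.toHom) (by
    rw [comp_lam, comp_lam, ← g.comm, Functor.map_comp_assoc]; rfl)
  whiskerRight f G := Hom.mk (f.toHom ▷ G.aut) (by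
    rw [comp_lam, comp_lam, ← f.comm]; exact (f.toHom.iso.hom.naturality_assoc _ _).symm)
  associator F G H := isoOfHom (Hom.mk (α_ F.aut G.aut H.aut).hom (by
    rw [comp_lam, comp_lam, comp_lam, comp_lam]
    exact (Category.id_comp _).trans
      ((congrArg (· ≫ F.lam) (F.aut.functor.map_comp _ _)).trans (Category.assoc _ _ _))))
  leftUnitor F := isoOfHom (Hom.mk (λ_ F.aut).hom (by
    rw [comp_lam, ofAut_lam]; exact (Category.id_comp _).trans (Category.comp_id _).symm))
  rightUnitor F := isoOfHom (Hom.mk (ρ_ F.aut).hom (by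
    rw [comp_lam, ofAut_lam]
    exact congrArg (· ≫ F.lam) (F.aut.functor.map_id A.X).symm))

instance : MonoidalCategory (BrAutOver A) where
  tensorHom_def f g := Hom.ext (tensorHom_def f.toHom g.toHom)
  id_tensorHom_id F G := Hom.ext (id_tensorHom_id F.aut G.aut)
  tensorHom_comp_tensorHom f₁ f₂ g₁ g₂ :=
    Hom.ext (tensorHom_comp_tensorHom f₁.toHom f₂.toHom g₁.toHom g₂.toHom)
  whiskerLeft_id F G := Hom.ext (whiskerLeft_id F.aut G.aut)
  id_whiskerRight F G := Hom.ext (id_whiskerRight F.aut G.aut)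
  associator_naturality f g h := Hom.ext (associator_naturality f.toHom g.toHom h.toHom)
  leftUnitor_naturality f := Hom.ext (leftUnitor_naturality f.toHom)
  rightUnitor_naturality f := Hom.ext (rightUnitor_naturality f.toHom)
  pentagon F G H K := Hom.ext (pentagon F.aut G.aut H.aut K.aut)
  triangle F G := Hom.ext (triangle F.aut G.aut)

theorem isIso_hom {F G : BrAutOver A} (f : F ⟶ G) : IsIso f := (isoOfHom f).isIso_hom

/-- The inverse `(α⁻¹, α⁻¹(λ⁻¹))`. -/
noncomputable def inverse (F : BrAutOver A) : BrAutOver A where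
  aut := F.aut.inverse
  algIso := F.aut.inverse.functor.mapMon.mapIso F.algIso.symm ≪≫ Functor.mapMonCompIso.symm.app A ≪≫
    (Functor.mapMonNatIso F.aut.inverseTensorIso.hom.iso).app A ≪≫ Functor.mapMonIdIso.app A

theorem inverse_comp_lam (F : BrAutOver A) :
    (F.inverse.comp F).lam = F.aut.inverseTensorIso.hom.iso.hom.app A.X := by
  have h : F.aut.inverse.functor.map F.lam ≫ F.aut.inverse.functor.map F.algIso.inv.hom =
      𝟙 _ := by
    rw [← Functor.map_comp]
    exact (congrArg (fun t => F.aut.inverse.functor.map (Mon.Hom.hom t)) F.algIso.hom_inv_id).trans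
      (F.aut.inverse.functor.map_id _)
  have h' : F.inverse.lam = F.aut.inverse.functor.map F.algIso.inv.hom ≫
      F.aut.inverseTensorIso.hom.iso.hom.app A.X :=
    congrArg (F.aut.inverse.functor.map F.algIso.inv.hom ≫ ·)
      ((Category.id_comp _).trans (Category.comp_id _))
  rw [comp_lam, h']
  exact (Category.assoc _ _ _).symm.trans
    ((congrArg (· ≫ F.aut.inverseTensorIso.hom.iso.hom.app A.X) h).trans (Category.id_comp _))

instance : IsCategoricalGroup (BrAutOver A) :=
  .of_leftInv _ isIso_hom fun F => ⟨F.inverse, ⟨isoOfHom (Hom.mk F.aut.inverseTensorIso.hom 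
    ((congrArg (F.aut.inverseTensorIso.hom.iso.hom.app A.X ≫ ·) (ofAut_lam 1)).trans
      ((Category.comp_id _).trans F.inverse_comp_lam.symm)))⟩⟩

variable (A) in
/-- The monoidal functor forgetting the algebra isomorphism. -/
def forget : BrAutOver A ⥤ BrAut C where
  obj F := F.aut
  map f := f.toHom

variable (A) in
def forgetCore : (forget A).CoreMonoidal :=
    { εIso := Iso.refl _
      μIso := fun _ _ => Iso.refl _
      μIso_hom_natural_left := fun _ _ => (Category.comp_id _).trans (Category.id_comp _).symm
      μIso_hom_natural_right := fun _ _ => (Category.comp_id _).trans (Category.id_comp _).symm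
      associativity := fun F G H =>
        have h : 𝟙 (F.aut ⊗ G.aut) ▷ H.aut ≫ 𝟙 ((F.aut ⊗ G.aut) ⊗ H.aut) ≫
            (α_ F.aut G.aut H.aut).hom = (α_ F.aut G.aut H.aut).hom ≫
            F.aut ◁ 𝟙 (G.aut ⊗ H.aut) ≫ 𝟙 (F.aut ⊗ G.aut ⊗ H.aut) := by simp
        h
      left_unitality := fun F =>
        have h : (λ_ F.aut).hom = 𝟙 (𝟙_ (BrAut C)) ▷ F.aut ≫ 𝟙 (𝟙_ (BrAut C) ⊗ F.aut) ≫
            (λ_ F.aut).hom := by simp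
        h
      right_unitality := fun F =>
        have h : (ρ_ F.aut).hom = F.aut ◁ 𝟙 (𝟙_ (BrAut C)) ≫ 𝟙 (F.aut ⊗ 𝟙_ (BrAut C)) ≫
            (ρ_ F.aut).hom := by simp
        h }

instance : (forget A).Monoidal := (forgetCore A).toMonoidal

end BrAutOver

variable (A : Mon C)

/-- The condition that `α(A)` and `A` are isomorphic as algebras. -/
def stabilizes : ObjectProperty (BrAut C) := fun F => Nonempty (F.functor.mapMon.obj A ≅ A)

instance : (stabilizes A).IsMonoidal where
  prop_unit := ⟨(BrAutOver.ofAut (1 : Aut A)).algIso⟩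
  prop_tensor F G := fun ⟨f⟩ ⟨g⟩ => ⟨(BrAutOver.comp ⟨F, f⟩ ⟨G, g⟩).algIso⟩

/-- The stabilizer of the algebra `A`: the full categorical subgroup of braided
autoequivalences `α` for which there is an algebra isomorphism `α(A) ≅ A`. -/
abbrev Stab := (stabilizes A).FullSubcategory

theorem Stab.isIso_hom {F G : Stab A} (f : F ⟶ G) : IsIso f :=
  ((stabilizes A).isoMk (BrAut.isoOfHom f.hom)).isIso_hom

instance : IsCategoricalGroup (Stab A) :=
  .of_leftInv _ (Stab.isIso_hom A) fun F =>
    ⟨⟨F.obj.inverse, F.property.elim fun f => ⟨(BrAutOver.inverse ⟨F.obj, f⟩).algIso⟩⟩,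
      ⟨(stabilizes A).isoMk F.obj.inverseTensorIso⟩⟩

/-- The forgetful monoidal functor `(α, ψ, λ) ↦ (α, ψ)` onto the stabilizer. -/
def toStab : BrAutOver A ⥤ Stab A :=
  (stabilizes A).lift (BrAutOver.forget A) fun F => ⟨F.algIso⟩

instance : (toStab A).Monoidal :=
  Functor.CoreMonoidal.toMonoidal
    { εIso := Iso.refl _
      μIso := fun _ _ => Iso.refl _
      μIso_hom_natural_left := fun _ _ => (Category.comp_id _).trans (Category.id_comp _).symm
      μIso_hom_natural_right := fun _ _ => (Category.comp_id _).trans (Category.id_comp _).symm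
      associativity := fun F G H =>
        (stabilizes A).ι.map_injective
          (Functor.CoreMonoidal.associativity (BrAutOver.forgetCore A) F G H)
      left_unitality := fun F =>
        (stabilizes A).ι.map_injective
          (Functor.CoreMonoidal.left_unitality (BrAutOver.forgetCore A) F)
      right_unitality := fun F =>
        (stabilizes A).ι.map_injective
          (Functor.CoreMonoidal.right_unitality (BrAutOver.forgetCore A) F) }

end Over

/-! ### Invertible objects and ring operators -/

section Ring

variable {C : Type u} [Category.{v} C] [MonoidalCategory C]

variable (C) in
/-- The group of isomorphism classes of invertible objects, with multiplication induced by the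
tensor product. -/
abbrev InvObj : Type u := (Skeleton C)ˣ

/-- A representative of an isomorphism class of invertible objects. -/
noncomputable def InvObj.obj (a : InvObj C) : C := (fromSkeleton C).obj (a : Skeleton C)

theorem InvObj.toSkeleton_obj (a : InvObj C) : toSkeleton a.obj = (a : Skeleton C) :=
  toSkeleton_fromSkeleton_obj _

theorem isEquivalence_tensorLeft {a b : C} (e : a ⊗ b ≅ 𝟙_ C) (f : b ⊗ a ≅ 𝟙_ C) :
    (tensorLeft a).IsEquivalence :=
  Equivalence.isEquivalence_functor (CategoryTheory.Equivalence.mk (tensorLeft a) (tensorLeft b)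
    (NatIso.ofComponents (fun X => (λ_ X).symm ≪≫ whiskerRightIso f.symm X ≪≫ α_ b a X)
      (by
        intro X Y g
        have h := whisker_exchange_assoc f.inv g (α_ b a Y).hom
        simp only [tensor_whiskerLeft, id_whiskerLeft] at h
        simp at h ⊢
        rw [← h]; simp))
    (NatIso.ofComponents (fun X => (α_ a b X).symm ≪≫ whiskerRightIso e X ≪≫ λ_ X)
      (by
        intro X Y g
        have h := whisker_exchange_assoc e.hom g (λ_ Y).hom
        simp at h ⊢
        rw [← h]; simp)))

theorem InvObj.isEquivalence_tensorLeft (a : InvObj C) : (tensorLeft a.obj).IsEquivalence := by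
  have h₁ : toSkeleton (a.obj ⊗ (a⁻¹).obj) = toSkeleton (𝟙_ C) := by
    rw [Skeleton.toSkeleton_tensorObj, toSkeleton_obj, toSkeleton_obj, Units.mul_inv]; rfl
  have h₂ : toSkeleton ((a⁻¹).obj ⊗ a.obj) = toSkeleton (𝟙_ C) := by
    rw [Skeleton.toSkeleton_tensorObj, toSkeleton_obj, toSkeleton_obj, Units.inv_mul]; rfl
  exact _root_.isEquivalence_tensorLeft (Skeleton.isoOfEq h₁) (Skeleton.isoOfEq h₂)

theorem InvObj.whiskerLeft_injective (a : InvObj C) {c d : C} {f g : c ⟶ d}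
    (h : a.obj ◁ f = a.obj ◁ g) : f = g := by
  have := a.isEquivalence_tensorLeft
  exact (tensorLeft a.obj).map_injective h

variable [BraidedCategory C]

theorem monodromy_naturality_right (a : C) {c d : C} (f : c ⟶ d) :
    a ◁ f ≫ monodromy a d = monodromy a c ≫ a ◁ f := by
  simp [monodromy]

theorem monodromy_naturality_left {a b : C} (f : a ⟶ b) (c : C) :
    f ▷ c ≫ monodromy b c = monodromy a c ≫ f ▷ c := by
  simp [monodromy]

theorem monodromy_tensor_right (a c d : C) :
    monodromy a (c ⊗ d) = (α_ a c d).inv ≫ (β_ a c).hom ▷ d ≫ (α_ c a d).hom ≫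
      c ◁ monodromy a d ≫ (α_ c a d).inv ≫ (β_ c a).hom ▷ d ≫ (α_ a c d).hom := by
  simp [monodromy, BraidedCategory.braiding_tensor_right_hom,
    BraidedCategory.braiding_tensor_left_hom]

theorem monodromy_tensor_left (a b c : C) :
    monodromy (a ⊗ b) c = (α_ a b c).hom ≫ a ◁ (β_ b c).hom ≫ (α_ a c b).inv ≫
      monodromy a c ▷ b ≫ (α_ a c b).hom ≫ a ◁ (β_ c b).hom ≫ (α_ a b c).inv := by
  simp [monodromy, BraidedCategory.braiding_tensor_right_hom,
    BraidedCategory.braiding_tensor_left_hom]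

instance (a c : C) : IsIso (monodromy a c) := by unfold monodromy; infer_instance

theorem Transparent.of_iso {a b : C} (e : a ≅ b) {c : C} (h : Transparent a c) :
    Transparent b c := by
  have := monodromy_naturality_left e.inv c
  rw [show monodromy a c = 𝟙 _ from h, Category.comp_id] at this
  rw [Transparent, ← cancel_mono (e.inv ▷ c), Category.id_comp, ← this]

/-- The component at `c` of the ring operator of an invertible object `a`: the unique morphism
`σ : c ⟶ c` such that `id_a ⊗ σ` is the double braiding of `a` and `c`. -/
noncomputable def ringIso (a : InvObj C) (c : C) : c ≅ c :=
  haveI := a.isEquivalence_tensorLeft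
  (tensorLeft a.obj).preimageIso (asIso (monodromy a.obj c))

theorem whiskerLeft_ringIso_obj (a : InvObj C) (c : C) :
    a.obj ◁ (ringIso a c).hom = monodromy a.obj c := by
  have := a.isEquivalence_tensorLeft
  exact (tensorLeft a.obj).map_preimage _

theorem whiskerLeft_ringIso (a : InvObj C) {x : C} (hx : toSkeleton x = (a : Skeleton C)) (c : C) :
    x ◁ (ringIso a c).hom = monodromy x c := by
  obtain e : x ≅ a.obj := Skeleton.isoOfEq (hx.trans a.toSkeleton_obj.symm)
  rw [← cancel_mono (e.hom ▷ c), whisker_exchange, whiskerLeft_ringIso_obj,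
    monodromy_naturality_left]

theorem ringIso_naturality (a : InvObj C) {c d : C} (f : c ⟶ d) :
    f ≫ (ringIso a d).hom = (ringIso a c).hom ≫ f := by
  apply a.whiskerLeft_injective
  simp only [MonoidalCategory.whiskerLeft_comp, whiskerLeft_ringIso_obj, monodromy_naturality_right]

theorem ringIso_tensor (a : InvObj C) (c d : C) :
    (ringIso a (c ⊗ d)).hom = (ringIso a c).hom ⊗ₘ (ringIso a d).hom := by
  apply a.whiskerLeft_injective
  rw [whiskerLeft_ringIso_obj, monodromy_tensor_right, ← whiskerLeft_ringIso_obj a d, MonoidalCategory.tensorHom_def,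
    MonoidalCategory.whiskerLeft_comp]
  have h : a.obj ◁ (ringIso a c).hom ▷ d = (α_ a.obj c d).inv ≫
      monodromy a.obj c ▷ d ≫ (α_ a.obj c d).hom := by
    rw [← whiskerLeft_ringIso_obj]; simp
  rw [h]
  have h₂ := whisker_exchange (β_ c a.obj).hom (ringIso a d).hom =≫ (α_ a.obj c d).hom
  simp only [tensor_whiskerLeft, Category.assoc, Iso.inv_hom_id, Category.comp_id] at h₂
  simp [monodromy, h₂]

theorem ringIso_unit (a : InvObj C) : (ringIso a (𝟙_ C)).hom = 𝟙 (𝟙_ C) := by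
  apply a.whiskerLeft_injective
  rw [whiskerLeft_ringIso_obj]
  simp [monodromy]

theorem eq_ringIso (a : InvObj C) {x : C} (hx : toSkeleton x = (a : Skeleton C)) {c : C}
    {f : c ⟶ c} (hf : x ◁ f = monodromy x c) : f = (ringIso a c).hom := by
  obtain e : x ≅ a.obj := Skeleton.isoOfEq (hx.trans a.toSkeleton_obj.symm)
  apply a.whiskerLeft_injective
  rw [whiskerLeft_ringIso_obj, ← cancel_epi (e.hom ▷ c), monodromy_naturality_left, ← hf,
    whisker_exchange]

theorem ringIso_one (c : C) : (ringIso (1 : InvObj C) c).hom = 𝟙 c :=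
  (eq_ringIso (1 : InvObj C) (x := 𝟙_ C) rfl (by simp [monodromy])).symm

theorem ringIso_mul (a b : InvObj C) (c : C) :
    (ringIso (a * b) c).hom = (ringIso b c).hom ≫ (ringIso a c).hom := by
  symm
  apply eq_ringIso (a * b) (x := a.obj ⊗ b.obj)
  · rw [Skeleton.toSkeleton_tensorObj, a.toSkeleton_obj, b.toSkeleton_obj]; rfl
  · rw [monodromy_tensor_left, ← whiskerLeft_ringIso_obj a c, ringIso_naturality]
    have h : (β_ b.obj c).hom ≫ (ringIso a c).hom ▷ b.obj ≫ (β_ c b.obj).hom =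
        b.obj ◁ (ringIso a c).hom ≫ b.obj ◁ (ringIso b c).hom := by
      rw [whiskerLeft_ringIso_obj]; simp [monodromy]
    have h' := congrArg (a.obj ◁ ·) h
    simp only [MonoidalCategory.whiskerLeft_comp] at h'
    simp [reassoc_of% h']

theorem transparent_iff_ringIso (a : InvObj C) {x : C} (hx : toSkeleton x = (a : Skeleton C))
    (c : C) : Transparent x c ↔ (ringIso a c).hom = 𝟙 c := by
  rw [Transparent, ← whiskerLeft_ringIso a hx c]
  refine ⟨fun h => (eq_ringIso a hx ?_).symm, fun h => by rw [h, whiskerLeft_id]⟩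
  rw [whiskerLeft_id, ← h, whiskerLeft_ringIso a hx c]

/-- The subgroup `c' ∩ Inv(C)` of (classes of) invertible objects that are transparent to `c`. -/
def transparentSubgroup (c : C) : Subgroup (InvObj C) where
  carrier := {a | ∀ x : C, toSkeleton x = (a : Skeleton C) → Transparent x c}
  one_mem' x hx := by rw [transparent_iff_ringIso 1 hx, ringIso_one]
  mul_mem' {a b} ha hb x hx := by
    rw [transparent_iff_ringIso (a * b) hx, ringIso_mul,
      (transparent_iff_ringIso a a.toSkeleton_obj c).1 (ha _ a.toSkeleton_obj),
      (transparent_iff_ringIso b b.toSkeleton_obj c).1 (hb _ b.toSkeleton_obj), Category.comp_id]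
  inv_mem' {a} ha x hx := by
    have h := ringIso_mul a⁻¹ a c
    rw [inv_mul_cancel, ringIso_one,
      (transparent_iff_ringIso a a.toSkeleton_obj c).1 (ha _ a.toSkeleton_obj),
      Category.id_comp] at h
    rw [transparent_iff_ringIso a⁻¹ hx, ← h]

end Ring

/-! ### The maps of the sequence -/

section Maps

variable {C : Type u} [Category.{v} C] [Abelian C] [Linear ℂ C] [MonoidalCategory C]
  [BraidedCategory C]

/-- The component at `c` of an element of `π₂` of the categorical group of braided
autoequivalences, i.e. of a monoidal natural automorphism of the identity functor. -/
def pi2App (t : Pi2 (BrAut C)) (c : C) : c ⟶ c := t.hom.iso.hom.app c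

/-- The ring operator of an invertible object, as a monoidal natural automorphism of the identity
functor. -/
noncomputable def ringNat (a : InvObj C) : 𝟙_ (BrAut C) ⟶ 𝟙_ (BrAut C) :=
  BrAut.Hom.mk (NatIso.ofComponents (F := 𝟭 C) (G := 𝟭 C) (ringIso a) (ringIso_naturality a))
    { unit := by
        exact (Category.id_comp _).trans (ringIso_unit a)
      tensor := fun c d => by
        exact (Category.id_comp _).trans ((ringIso_tensor a c d).trans (Category.comp_id _).symm) }

/-- The ring operator homomorphism `a ↦ σ^a` from `Inv(C)` to `π₂`. -/
noncomputable def ringOperator : InvObj C →* Pi2 (BrAut C) where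
  toFun a := BrAut.isoOfHom (ringNat a)
  map_one' := Iso.ext (BrAut.hom_ext ringIso_one)
  map_mul' a b := Iso.ext (BrAut.hom_ext (ringIso_mul a b))

/-- The ring operator is characterized by `β_{c,x} ∘ β_{x,c} = id_x ⊗ σ^x_c`. -/
theorem whiskerLeft_ringOperator (a : InvObj C) {x : C} (hx : toSkeleton x = (a : Skeleton C))
    (c : C) : x ◁ pi2App (ringOperator a) c = (β_ x c).hom ≫ (β_ c x).hom :=
  whiskerLeft_ringIso a hx c

variable (A : Mon C)

/-- Evaluation at the algebra `A` of a monoidal natural automorphism of the identity functor. It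
takes values in `Aut_C(A)`, the group of algebra automorphisms of `A`. -/
def evalAt : Pi2 (BrAut C) →* Aut A where
  toFun t := Mon.mkIso (t.hom.iso.app A.X)
    (by
      have h₁ : η[A.X] ≫ pi2App t A.X = pi2App t (𝟙_ C) ≫ η[A.X] :=
        t.hom.iso.hom.naturality η[A.X]
      have h₂ : 𝟙 (𝟙_ C) ≫ pi2App t (𝟙_ C) = 𝟙 (𝟙_ C) := t.hom.isMonoidal.unit
      rw [Category.id_comp] at h₂
      rw [h₂, Category.id_comp] at h₁
      exact h₁)
    (by
      have h₁ : μ[A.X] ≫ pi2App t A.X = pi2App t (A.X ⊗ A.X) ≫ μ[A.X] :=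
        t.hom.iso.hom.naturality μ[A.X]
      have h₂ : 𝟙 (A.X ⊗ A.X) ≫ pi2App t (A.X ⊗ A.X) =
          (pi2App t A.X ⊗ₘ pi2App t A.X) ≫ 𝟙 (A.X ⊗ A.X) := t.hom.isMonoidal.tensor A.X A.X
      rw [Category.id_comp, Category.comp_id] at h₂
      rw [h₂] at h₁
      exact h₁)
  map_one' := Iso.ext (Mon.Hom.ext rfl)
  map_mul' _ _ := Iso.ext (Mon.Hom.ext rfl)

/-- The map `σ_A : Inv(C) → Aut_C(A)`, `a ↦ σ^a_A`. -/
noncomputable def sigma : InvObj C →* Aut A := (evalAt A).comp ringOperator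

/-- The map `λ ↦ [id_C, λ]` from `Aut_C(A)` to the truncation of the categorical group of
braided autoequivalences over `A`. -/
def autToPi1 : Aut A →* Pi1 (BrAutOver A) where
  toFun l := toSkeleton (BrAutOver.ofAut l)
  map_one' := rfl
  map_mul' l m := by
    rw [← Skeleton.toSkeleton_tensorObj]
    refine (congr_toSkeleton_of_iso (BrAutOver.isoOfHom
      (F := (BrAutOver.ofAut l).comp (BrAutOver.ofAut m)) (G := BrAutOver.ofAut (l * m))
      (BrAutOver.Hom.mk (λ_ (𝟙_ (BrAut C))).hom ?_))).symm
    rw [BrAutOver.comp_lam, BrAutOver.ofAut_lam, BrAutOver.ofAut_lam, BrAutOver.ofAut_lam]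
    exact Category.id_comp _

end Maps

/-! The deep point is that `ringOperator` is bijective. Granted this, exactness is formal: an
isomorphism from `(id, λ)` to the identity triple is a monoidal automorphism of the identity functor
with value `λ` at `A`, and an isomorphism `id ≅ α` turns `λ : α(A) → A` into an automorphism of `A`.

Injectivity: invertible objects are simple, and one with trivial ring operator is transparent to
everything, hence is the unit by non-degeneracy.

Surjectivity: let `t` be a monoidal automorphism of the identity with inverse `u`. For simple `c`,
let `N_c : c ⟶ c` be the weighted sum over simple `X` of the partial traces of the monodromy of `c`
and `X` composed with `u X`. The weighted sum behaves like a Haar integral (`integral_tensor`), so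
`N_c` absorbs `monodromy c y ≫ c ◁ u y` (`integral_monodromy`). If `N_c ≠ 0`, it is invertible by
Schur's lemma and the monodromy of `c` is `t`. Not all `N_c` vanish: otherwise their traces, summed
over `c` with dimension weights, would vanish, while the same dichotomy for `t = id` leaves only the
contribution of the unit, a nonzero multiple of the global dimension (`exists_irr_monodromy_eq`). A
simple `c` with monodromy `t` is invertible, because `c ⊗ c*` is transparent.

The global dimension is nonzero although no pivotal structure is given. Dimensions defined through
the braiding are multiplicative only after inserting the monodromy. Its square is a scalar on each
multiplicity space (`scalarOf_monodromy_sq`), so the phase of its trace is known. Comparing the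
dimensions with their rescaled complex conjugates rewrites the global dimension as a sum of positive
numbers. -/

set_option linter.unusedSectionVars false

/-! ### Partial traces and mates -/

section Planar

variable {C : Type u} [Category.{v} C] [MonoidalCategory C]

/-- The right partial trace of a morphism `V ⊗ X ⟶ W ⊗ X`, closing the strand `X` with the
coevaluation of the pairing `(X, X')` and the evaluation of the pairing `(X', X)`. -/
def partialTrace {V W X : C} (X' : C) [ExactPairing X X'] [ExactPairing X' X]
    (φ : V ⊗ X ⟶ W ⊗ X) : V ⟶ W :=
  (ρ_ V).inv ≫ V ◁ η_ X X' ≫ (α_ V X X').inv ≫ φ ▷ X' ≫ (α_ W X X').hom ≫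
    W ◁ ε_ X' X ≫ (ρ_ W).hom

theorem comp_partialTrace {U V W X : C} (X' : C) [ExactPairing X X'] [ExactPairing X' X]
    (f : U ⟶ V) (φ : V ⊗ X ⟶ W ⊗ X) :
    partialTrace X' (f ▷ X ≫ φ) = f ≫ partialTrace X' φ := by
  calc
    _ = (ρ_ U).inv ≫ (U ◁ η_ X X' ≫ f ▷ _) ≫ (α_ V X X').inv ≫ φ ▷ X' ≫ (α_ W X X').hom ≫
        W ◁ ε_ X' X ≫ (ρ_ W).hom := by simp [partialTrace]
    _ = _ := by rw [whisker_exchange]; simp [partialTrace]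

theorem partialTrace_comp {V W Z X : C} (X' : C) [ExactPairing X X'] [ExactPairing X' X]
    (φ : V ⊗ X ⟶ W ⊗ X) (f : W ⟶ Z) :
    partialTrace X' (φ ≫ f ▷ X) = partialTrace X' φ ≫ f := by
  calc
    _ = (ρ_ V).inv ≫ V ◁ η_ X X' ≫ (α_ V X X').inv ≫ φ ▷ X' ≫ (α_ W X X').hom ≫
        (f ▷ _ ≫ _ ◁ ε_ X' X) ≫ (ρ_ Z).hom := by simp [partialTrace]
    _ = _ := by rw [← whisker_exchange]; simp [partialTrace]

theorem whiskerLeft_partialTrace {V W X : C} (Y X' : C) [ExactPairing X X'] [ExactPairing X' X]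
    (φ : V ⊗ X ⟶ W ⊗ X) :
    Y ◁ partialTrace X' φ =
      partialTrace X' ((α_ Y V X).hom ≫ Y ◁ φ ≫ (α_ Y W X).inv) := by
  simp only [partialTrace]; monoidal

variable {y i i' k k' : C}

section

variable [ExactPairing i i'] [ExactPairing k k']

/-- The morphism `k' ⊗ y ⟶ i'` obtained from `y ⊗ i ⟶ k` by bending both strands `i` and `k`. -/
def mateDown (i' k' : C) [ExactPairing i i'] [ExactPairing k k'] (f : y ⊗ i ⟶ k) : k' ⊗ y ⟶ i' :=
  (tensorLeftHomEquiv y k k' i').symm (tensorRightHomEquiv y i i' k f)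

theorem mateDown_coevaluation (f : y ⊗ i ⟶ k) :
    (λ_ y).inv ≫ η_ k k' ▷ y ≫ (α_ _ _ _).hom ≫ k ◁ mateDown i' k' f =
      (ρ_ y).inv ≫ y ◁ η_ i i' ≫ (α_ _ _ _).inv ≫ f ▷ i' :=
  (tensorLeftHomEquiv y k k' i').apply_symm_apply (tensorRightHomEquiv y i i' k f)

theorem mateDown_evaluation (f : y ⊗ i ⟶ k) :
    mateDown i' k' f ▷ i ≫ ε_ i i' = (α_ _ _ _).hom ≫ k' ◁ f ≫ ε_ k k' := by
  have h : (tensorRightHomEquiv y i i' k f) ▷ i ≫ (α_ _ _ _).hom ≫ k ◁ ε_ i i' ≫ (ρ_ k).hom = f :=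
    (tensorRightHomEquiv y i i' k).symm_apply_apply f
  set F := tensorRightHomEquiv y i i' k f
  have h' : mateDown i' k' f = k' ◁ F ≫ (α_ _ _ _).inv ≫ ε_ k k' ▷ i' ≫ (λ_ i').hom := rfl
  rw [h']
  calc
    _ = (α_ _ _ _).hom ≫ k' ◁ F ▷ i ⊗≫ (ε_ k k' ▷ (i' ⊗ i) ≫ 𝟙_ C ◁ ε_ i i') ⊗≫ 𝟙 _ := by monoidal
    _ = (α_ _ _ _).hom ≫ k' ◁ (F ▷ i ≫ (α_ _ _ _).hom ≫ k ◁ ε_ i i' ≫ (ρ_ k).hom) ≫ ε_ k k' := by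
      rw [← whisker_exchange]; monoidal
    _ = _ := by rw [h]

end

section

variable [ExactPairing i' i] [ExactPairing k' k]

/-- The bijection between morphisms `k ⟶ y ⊗ i` and `i' ⟶ k' ⊗ y` obtained by bending both strands
`i` and `k`. -/
def mateUp (y i' k' : C) [ExactPairing i' i] [ExactPairing k' k] :
    (k ⟶ y ⊗ i) ≃ (i' ⟶ k' ⊗ y) :=
  (tensorRightHomEquiv k i' i y).symm.trans (tensorLeftHomEquiv i' k' k y)

theorem mateUp_evaluation (g : k ⟶ y ⊗ i) :
    k ◁ mateUp y i' k' g ≫ (α_ _ _ _).inv ≫ ε_ k' k ▷ y ≫ (λ_ y).hom =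
      g ▷ i' ≫ (α_ _ _ _).hom ≫ y ◁ ε_ i' i ≫ (ρ_ y).hom :=
  (tensorLeftHomEquiv i' k' k y).symm_apply_apply ((tensorRightHomEquiv k i' i y).symm g)

theorem mateUp_coevaluation (g : k ⟶ y ⊗ i) :
    η_ i' i ≫ mateUp y i' k' g ▷ i = η_ k' k ≫ k' ◁ g ≫ (α_ _ _ _).inv := by
  have h : (ρ_ k).inv ≫ k ◁ η_ i' i ≫ (α_ _ _ _).inv ≫
      ((tensorRightHomEquiv k i' i y).symm g) ▷ i = g :=
    (tensorRightHomEquiv k i' i y).apply_symm_apply g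
  set G := (tensorRightHomEquiv k i' i y).symm g
  have h' : mateUp y i' k' g = (λ_ i').inv ≫ η_ k' k ▷ i' ≫ (α_ _ _ _).hom ≫ k' ◁ G := rfl
  rw [h']
  calc
    _ = (𝟙 _ ⊗≫ 𝟙_ C ◁ η_ i' i ≫ η_ k' k ▷ (i' ⊗ i)) ⊗≫ k' ◁ G ▷ i ⊗≫ 𝟙 _ := by monoidal
    _ = η_ k' k ≫ k' ◁ ((ρ_ k).inv ≫ k ◁ η_ i' i ≫ (α_ _ _ _).inv ≫ G ▷ i) ≫ (α_ _ _ _).inv := by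
      rw [whisker_exchange]; monoidal
    _ = _ := by rw [h]

end

variable [ExactPairing i i'] [ExactPairing k k'] [ExactPairing i' i] [ExactPairing k' k]

/-- Both sides are the same closed planar diagram in `f` and `g`, cut open along different strands.
This compares the composition pairings before and after bending. -/
theorem mateUp_comp_mateDown (f : y ⊗ i ⟶ k) (g : k ⟶ y ⊗ i) :
    η_ i' i ≫ (mateUp y i' k' g ≫ mateDown i' k' f) ▷ i ≫ ε_ i i' =
      η_ k' k ≫ k' ◁ (g ≫ f) ≫ ε_ k k' := by
  rw [comp_whiskerRight, Category.assoc, mateDown_evaluation, reassoc_of% mateUp_coevaluation g]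
  simp

/-- A partial trace over `k` in which an endomorphism of `k' ⊗ y` is inserted. -/
def insertTrace {V W : C} (y k' : C) [ExactPairing k k'] [ExactPairing k' k]
    (φ : V ⊗ k ⟶ W ⊗ k) (θ : k' ⊗ y ⟶ k' ⊗ y) : V ⊗ y ⟶ W ⊗ y :=
  V ◁ ((λ_ y).inv ≫ η_ k k' ▷ y ≫ (α_ _ _ _).hom ≫ k ◁ θ) ≫ (α_ _ _ _).inv ≫
    φ ▷ (k' ⊗ y) ≫ (α_ _ _ _).hom ≫ W ◁ ((α_ _ _ _).inv ≫ ε_ k' k ▷ y ≫ (λ_ y).hom)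

theorem insertTrace_id {V W : C} (φ : V ⊗ k ⟶ W ⊗ k) :
    insertTrace y k' φ (𝟙 _) = partialTrace k' φ ▷ y := by
  simp only [insertTrace, partialTrace]; monoidal

/-- Sliding `f` and `g` around the loop of `i` turns it into a loop of `k`, with `i'` left only
between the two mates. A sum over `i` can then be carried out inside the inserted endomorphism of
`k' ⊗ y`. -/
theorem partialTrace_eq_insertTrace {V W : C} (φ : V ⊗ k ⟶ W ⊗ k) (f : y ⊗ i ⟶ k)
    (g : k ⟶ y ⊗ i) :
    partialTrace i' ((α_ _ _ _).hom ≫ (V ◁ f ≫ φ ≫ W ◁ g) ≫ (α_ _ _ _).inv) =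
      insertTrace y k' φ (mateDown i' k' f ≫ mateUp y i' k' g) := by
  have h : insertTrace y k' φ (mateDown i' k' f ≫ mateUp y i' k' g) =
      V ◁ ((λ_ y).inv ≫ η_ k k' ▷ y ≫ (α_ _ _ _).hom ≫ k ◁ mateDown i' k' f) ⊗≫
        ((V ⊗ k) ◁ mateUp y i' k' g ≫ φ ▷ (k' ⊗ y)) ⊗≫
          W ◁ ((α_ _ _ _).inv ≫ ε_ k' k ▷ y ≫ (λ_ y).hom) := by
    simp only [insertTrace]; monoidal
  rw [h, whisker_exchange, mateDown_coevaluation]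
  calc
    _ = V ◁ ((ρ_ y).inv ≫ y ◁ η_ i i' ≫ (α_ _ _ _).inv ≫ f ▷ i') ⊗≫ φ ▷ i' ⊗≫
        W ◁ (g ▷ i' ≫ (α_ _ _ _).hom ≫ y ◁ ε_ i' i ≫ (ρ_ y).hom) := by
      simp only [partialTrace]; monoidal
    _ = _ := by
      rw [← mateUp_evaluation (k' := k')]; monoidal

end Planar

/-! ### Semisimplicity -/

section Irr

variable {C : Type u} [Category.{v} C] [Abelian C]

variable (C) in
/-- The isomorphism classes of simple objects. -/
def Irr : Type u := {q : Skeleton C // Simple ((fromSkeleton C).obj q)}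

/-- A representative of an isomorphism class of simple objects. -/
noncomputable def Irr.obj (k : Irr C) : C := (fromSkeleton C).obj k.1

instance (k : Irr C) : Simple k.obj := k.2

theorem Irr.eq_of_iso {k l : Irr C} (e : k.obj ≅ l.obj) : k = l := by
  apply Subtype.ext
  rw [← toSkeleton_fromSkeleton_obj k.1, ← toSkeleton_fromSkeleton_obj l.1]
  exact congr_toSkeleton_of_iso e

theorem Irr.exists_iso (X : C) [Simple X] : ∃ k : Irr C, Nonempty (X ≅ k.obj) := by
  have e : X ≅ (fromSkeleton C).obj (toSkeleton X) :=
    Skeleton.isoOfEq (toSkeleton_fromSkeleton_obj _).symm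
  exact ⟨⟨toSkeleton X, Simple.of_iso e.symm⟩, ⟨e⟩⟩

theorem Irr.hom_eq_zero {k l : Irr C} (h : k ≠ l) (f : k.obj ⟶ l.obj) : f = 0 := by
  by_contra hf
  have := isIso_of_hom_simple hf
  exact h (Irr.eq_of_iso (asIso f))

noncomputable instance : DecidableEq (Irr C) := Classical.decEq _

end Irr


section Semisimple

attribute [local instance] Abelian.hasFiniteBiproducts

variable {C : Type u} [Category.{v} C] [Abelian C] [Linear ℂ C] [MonoidalCategory C]
  [MonoidalPreadditive C] [MonoidalLinear ℂ C] [RigidCategory C]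

instance [IsFusionCategory C] (X Y : C) : FiniteDimensional ℂ (X ⟶ Y) :=
  IsFusionCategory.finiteDimensional_hom X Y

instance [IsFusionCategory C] : Simple (𝟙_ C) := IsFusionCategory.simple_unit

/-- The scalar by which an endomorphism of a simple object acts. -/
noncomputable def scalarOf [IsFusionCategory C] (X : C) [Simple X] : (X ⟶ X) ≃ₗ[ℂ] ℂ :=
  (LinearEquiv.ofBijective (LinearMap.toSpanSingleton ℂ (X ⟶ X) (𝟙 X))
    ⟨smul_left_injective ℂ (id_nonzero X), endomorphism_simple_eq_smul_id ℂ⟩).symm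

theorem scalarOf_smul_id [IsFusionCategory C] {X : C} [Simple X] (f : X ⟶ X) :
    scalarOf X f • 𝟙 X = f :=
  (scalarOf X).symm_apply_apply f

@[simp] theorem scalarOf_id [IsFusionCategory C] (X : C) [Simple X] : scalarOf X (𝟙 X) = 1 := by
  apply smul_left_injective ℂ (id_nonzero X)
  simp only [scalarOf_smul_id, one_smul]

instance [IsFusionCategory C] : Finite (Irr C) := by
  obtain ⟨n, S, hS⟩ := IsFusionCategory.finite_simples (C := C)
  choose i hi using fun k : Irr C => hS k.obj inferInstance
  exact Finite.of_injective i fun k l h =>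
    Irr.eq_of_iso ((hi k).some ≪≫ eqToIso (congrArg S h) ≪≫ (hi l).some.symm)

noncomputable instance [IsFusionCategory C] : Fintype (Irr C) := Fintype.ofFinite _

variable [IsFusionCategory C]

/-- A decomposition of an object into simple objects. -/
structure Decomp (X : C) where
  idx : Irr C → Type
  [fintype : ∀ k, Fintype (idx k)]
  [decEq : ∀ k, DecidableEq (idx k)]
  proj : ∀ k, idx k → (X ⟶ k.obj)
  incl : ∀ k, idx k → (k.obj ⟶ X)
  incl_proj : ∀ k a b, incl k a ≫ proj k b = if a = b then 𝟙 _ else 0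
  total : ∑ k, ∑ a, proj k a ≫ incl k a = 𝟙 X

attribute [instance] Decomp.fintype Decomp.decEq

theorem exists_decomp (X : C) : Nonempty (Decomp X) := by
  classical
  obtain ⟨n, S, hS, ⟨e⟩⟩ := IsFusionCategory.semisimple X
  choose κ hκ using fun a => have := hS a; Irr.exists_iso (S a)
  let θ (a : Fin n) : S a ≅ (κ a).obj := (hκ a).some
  have key (k : Irr C) (a : {a // κ a = k}) : (κ a.1).obj = k.obj := by rw [a.2]
  refine ⟨{ idx := fun k => {a // κ a = k}
            proj := fun k a => e.hom ≫ Limits.biproduct.π S a.1 ≫ (θ a.1).hom ≫ eqToHom (key k a)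
            incl := fun k a => eqToHom (key k a).symm ≫ (θ a.1).inv ≫ Limits.biproduct.ι S a.1 ≫ e.inv
            incl_proj := ?_
            total := ?_ }⟩
  · rintro k ⟨a, rfl⟩ ⟨b, hb⟩
    by_cases hab : a = b
    · subst hab; simp
    · simp [hab, Limits.biproduct.ι_π_ne_assoc S hab]
  · have h : ∀ k (a : {a // κ a = k}), (e.hom ≫ Limits.biproduct.π S a.1 ≫ (θ a.1).hom ≫
        eqToHom (key k a)) ≫ eqToHom (key k a).symm ≫ (θ a.1).inv ≫ Limits.biproduct.ι S a.1 ≫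
          e.inv = e.hom ≫ (Limits.biproduct.π S a.1 ≫ Limits.biproduct.ι S a.1) ≫ e.inv := by
      intro k a; simp
    simp only [h]
    rw [← Fintype.sum_sigma' (fun k (a : {a // κ a = k}) =>
      e.hom ≫ (Limits.biproduct.π S a.1 ≫ Limits.biproduct.ι S a.1) ≫ e.inv)]
    refine (Fintype.sum_equiv (Equiv.sigmaFiberEquiv κ) _
      (fun a => e.hom ≫ (Limits.biproduct.π S a ≫ Limits.biproduct.ι S a) ≫ e.inv)
      (fun _ => rfl)).trans ?_
    rw [← Preadditive.comp_sum, ← Preadditive.sum_comp, Limits.biproduct.total]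
    simp

/-- A chosen decomposition of an object into simple objects. -/
noncomputable def decomp (X : C) : Decomp X := (exists_decomp X).some

namespace Decomp

variable {X : C} (d : Decomp X)

theorem comp_proj_zero {k l : Irr C} (h : k ≠ l) (f : k.obj ⟶ X) (b : d.idx l) :
    f ≫ d.proj l b = 0 := Irr.hom_eq_zero h _

theorem hom_eq {k : Irr C} (f : k.obj ⟶ X) :
    f = ∑ a, scalarOf k.obj (f ≫ d.proj k a) • d.incl k a := by
  conv_lhs => rw [← Category.comp_id f, ← d.total, Preadditive.comp_sum]
  rw [Finset.sum_eq_single k]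
  · rw [Preadditive.comp_sum]
    refine Finset.sum_congr rfl fun a _ => ?_
    conv_lhs => rw [← Category.assoc, ← scalarOf_smul_id (f ≫ d.proj k a)]
    simp
  · intro l _ h
    rw [Preadditive.comp_sum]
    refine Finset.sum_eq_zero fun a _ => ?_
    rw [← Category.assoc, d.comp_proj_zero h.symm, Limits.zero_comp]
  · simp

end Decomp

theorem hom_ext_of_irr {X Y : C} {f g : X ⟶ Y} (h : ∀ (k : Irr C) (x : k.obj ⟶ X), x ≫ f = x ≫ g) :
    f = g := by
  rw [← Category.id_comp f, ← Category.id_comp g, ← (decomp X).total]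
  simp [Preadditive.sum_comp, h]

/-- A nonzero morphism from a simple object splits. -/
theorem exists_retraction {s X : C} [Simple s] {g : s ⟶ X} (hg : g ≠ 0) :
    ∃ f : X ⟶ s, g ≫ f = 𝟙 s := by
  by_contra! H
  apply hg
  rw [← Category.comp_id g, ← (decomp X).total, Preadditive.comp_sum]
  refine Finset.sum_eq_zero fun k _ => ?_
  rw [Preadditive.comp_sum]
  refine Finset.sum_eq_zero fun a _ => ?_
  by_cases h : g ≫ (decomp X).proj k a = 0
  · rw [← Category.assoc, h, Limits.zero_comp]
  · have := isIso_of_hom_simple h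
    exact absurd (by rw [← Category.assoc]; exact IsIso.hom_inv_id _)
      (H ((decomp X).proj k a ≫ inv (g ≫ (decomp X).proj k a)))

theorem exists_irr_hom_ne_zero {X : C} (hX : 𝟙 X ≠ 0) : ∃ (k : Irr C) (x : k.obj ⟶ X), x ≠ 0 := by
  by_contra! H
  exact hX (hom_ext_of_irr fun k x => by rw [H k x]; simp)

/-! ### Simple objects and their duals -/

section Dual

variable {X X' : C} [ExactPairing X X']

theorem coevaluation_ne_zero [Simple X] : η_ X X' ≠ 0 := by
  intro h
  have := ExactPairing.evaluation_coevaluation X X'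
  rw [h, MonoidalPreadditive.zero_whiskerRight, Limits.zero_comp] at this
  apply id_nonzero X
  rw [← cancel_epi (λ_ X).hom, ← cancel_mono (ρ_ X).inv]
  simpa using this.symm

/-- Morphisms `X' ⊗ X ⟶ 𝟙_ C` are multiples of the evaluation if `X` is simple. -/
theorem eq_smul_evaluation [Simple X] (a : X' ⊗ X ⟶ 𝟙_ C) : ∃ c : ℂ, a = c • ε_ X X' := by
  refine ⟨scalarOf X (tensorLeftHomEquiv X X X' (𝟙_ C) a ≫ (ρ_ X).hom), ?_⟩
  apply (tensorLeftHomEquiv X X X' (𝟙_ C)).injective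
  rw [← cancel_mono (ρ_ X).hom]
  conv_lhs => rw [← scalarOf_smul_id (tensorLeftHomEquiv X X X' (𝟙_ C) a ≫ (ρ_ X).hom)]
  simp [tensorLeftHomEquiv]

/-- Morphisms `X' ⊗ X ⟶ 𝟙_ C` are multiples of the evaluation if `X'` is simple. -/
theorem eq_smul_evaluation' [Simple X'] (a : X' ⊗ X ⟶ 𝟙_ C) : ∃ c : ℂ, a = c • ε_ X X' := by
  refine ⟨scalarOf X' (tensorRightHomEquiv X' X X' (𝟙_ C) a ≫ (λ_ X').hom), ?_⟩
  apply (tensorRightHomEquiv X' X X' (𝟙_ C)).injective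
  rw [← cancel_mono (λ_ X').hom]
  conv_lhs => rw [← scalarOf_smul_id (tensorRightHomEquiv X' X X' (𝟙_ C) a ≫ (λ_ X').hom)]
  simp [tensorRightHomEquiv]

/-- The coevaluation is a nonzero map out of the simple unit, so it has a retraction; up to a scalar
that retraction can only be the evaluation of the opposite pairing. -/
theorem coevaluation_comp_ne_zero [Simple X] [ExactPairing X' X] : η_ X X' ≫ ε_ X' X ≠ 0 := by
  intro h
  obtain ⟨f, hf⟩ := exists_retraction (coevaluation_ne_zero (X := X) (X' := X'))
  obtain ⟨c, rfl⟩ := eq_smul_evaluation' (X := X') (X' := X) f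
  rw [Linear.comp_smul, h, smul_zero] at hf
  exact id_nonzero (𝟙_ C) hf.symm

theorem end_dual_eq_smul [Simple X] (φ : X' ⟶ X') : ∃ c : ℂ, φ = c • 𝟙 X' := by
  obtain ⟨c, hc⟩ := eq_smul_evaluation ((tensorRightHomEquiv X' X X' (𝟙_ C)).symm (φ ≫ (λ_ X').inv))
  refine ⟨c, ?_⟩
  rw [Equiv.symm_apply_eq] at hc
  rw [← cancel_mono (λ_ X').inv, hc]
  simp [tensorRightHomEquiv]

-- Duality makes every endomorphism of `X'` a scalar. The idempotent cutting out a simple summand of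
-- `X'` is therefore the identity.
variable (X X') in
theorem simple_dual [Simple X] : Simple X' := by
  have h1 : 𝟙 X' ≠ 0 := by
    intro h
    apply coevaluation_ne_zero (X := X) (X' := X')
    rw [← Category.comp_id (η_ X X'), ← whiskerLeft_id, h, MonoidalPreadditive.whiskerLeft_zero,
      Limits.comp_zero]
  obtain ⟨k, x, hx⟩ := exists_irr_hom_ne_zero h1
  obtain ⟨f, hf⟩ := exists_retraction hx
  obtain ⟨c, hc⟩ := end_dual_eq_smul (X := X) (f ≫ x)
  have h2 : x = c • x := by
    calc x = x ≫ (f ≫ x) := by rw [reassoc_of% hf]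
      _ = c • x := by rw [hc]; simp
  have hc1 : c = 1 := by
    have : (c - 1) • x = 0 := by rw [sub_smul, one_smul, ← h2, sub_self]
    rcases smul_eq_zero.1 this with h | h
    · linear_combination h
    · exact absurd h hx
  rw [hc1, one_smul] at hc
  exact Simple.of_iso (Y := k.obj) ⟨f, x, hc, hf⟩

end Dual

end Semisimple

/-! ### The integral -/

section Integral

variable {C : Type u} [Category.{v} C] [Abelian C] [Linear ℂ C] [MonoidalCategory C]
  [MonoidalPreadditive C] [MonoidalLinear ℂ C]

section Linear

variable {V W X X' : C} [ExactPairing X X'] [ExactPairing X' X]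

theorem partialTrace_smul (c : ℂ) (φ : V ⊗ X ⟶ W ⊗ X) :
    partialTrace X' (c • φ) = c • partialTrace X' φ := by
  simp [partialTrace]

theorem partialTrace_sum {J : Type*} (s : Finset J) (φ : J → (V ⊗ X ⟶ W ⊗ X)) :
    partialTrace X' (∑ j ∈ s, φ j) = ∑ j ∈ s, partialTrace X' (φ j) := by
  simp [partialTrace, sum_whiskerRight, Preadditive.comp_sum, Preadditive.sum_comp]

theorem insertTrace_smul {y : C} (c : ℂ) (φ : V ⊗ X ⟶ W ⊗ X) (θ : X' ⊗ y ⟶ X' ⊗ y) :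
    insertTrace y X' φ (c • θ) = c • insertTrace y X' φ θ := by
  simp [insertTrace]

theorem insertTrace_sum {y : C} {J : Type*} (s : Finset J) (φ : V ⊗ X ⟶ W ⊗ X)
    (θ : J → (X' ⊗ y ⟶ X' ⊗ y)) :
    insertTrace y X' φ (∑ j ∈ s, θ j) = ∑ j ∈ s, insertTrace y X' φ (θ j) := by
  simp [insertTrace, whiskerLeft_sum, Preadditive.comp_sum, Preadditive.sum_comp]

end Linear

variable [RigidCategory C] [IsFusionCategory C] [∀ X : C, ExactPairing Xᘁ X]

instance (X : C) [Simple X] : Simple Xᘁ := simple_dual X Xᘁ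

/-- The right dimension of an object, with respect to the chosen pairings. -/
noncomputable def dimRight (X : C) : ℂ := scalarOf (𝟙_ C) (η_ X Xᘁ ≫ ε_ Xᘁ X)

/-- The left dimension of an object, with respect to the chosen pairings. -/
noncomputable def dimLeft (X : C) : ℂ := scalarOf (𝟙_ C) (η_ Xᘁ X ≫ ε_ X Xᘁ)

theorem dimRight_ne_zero (X : C) [Simple X] : dimRight X ≠ 0 :=
  (scalarOf (𝟙_ C)).map_eq_zero_iff.not.2 coevaluation_comp_ne_zero

theorem dimLeft_ne_zero (X : C) [Simple X] : dimLeft X ≠ 0 :=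
  (scalarOf (𝟙_ C)).map_eq_zero_iff.not.2 coevaluation_comp_ne_zero

/-- Bending preserves the composition pairing only up to the factor `dimLeft k / dimLeft i`. This is
why `integral` carries the weights `dimLeft`. -/
theorem scalarOf_mateUp_comp_mateDown {y i k : C} [Simple i] [Simple k] (f : y ⊗ i ⟶ k)
    (g : k ⟶ y ⊗ i) :
    scalarOf iᘁ (mateUp y iᘁ kᘁ g ≫ mateDown iᘁ kᘁ f) * dimLeft i =
      scalarOf k (g ≫ f) * dimLeft k := by
  have h := mateUp_comp_mateDown (i' := iᘁ) (k' := kᘁ) f g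
  rw [← scalarOf_smul_id (mateUp y iᘁ kᘁ g ≫ mateDown iᘁ kᘁ f), ← scalarOf_smul_id (g ≫ f)] at h
  simpa [dimLeft] using congrArg (scalarOf (𝟙_ C)) h

theorem mateUp_sum {y i k : C} {J : Type*} (s : Finset J) (c : J → ℂ) (g : J → (k ⟶ y ⊗ i)) :
    mateUp y iᘁ kᘁ (∑ j ∈ s, c j • g j) = ∑ j ∈ s, c j • mateUp y iᘁ kᘁ (g j) := by
  simp [mateUp, tensorLeftHomEquiv, tensorRightHomEquiv, whiskerLeft_sum, sum_whiskerRight,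
    Preadditive.comp_sum, Preadditive.sum_comp]

theorem dual_hom_eq_zero {i j : Irr C} (h : i ≠ j) (f : i.objᘁ ⟶ j.objᘁ) : f = 0 := by
  by_contra hf
  have := isIso_of_hom_simple hf
  exact h (Irr.eq_of_iso (leftDualIso inferInstance (exactPairingCongrRight (asIso f))))

/-- Take `i` in the class of the dual of `k`; the pairing `(kᘁ, k)` exhibits `k` as a dual of `kᘁ`.
-/
theorem exists_dual_iso (k : Irr C) : ∃ i : Irr C, Nonempty (i.objᘁ ≅ k.obj) := by
  obtain ⟨i, ⟨e⟩⟩ := Irr.exists_iso k.objᘁ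
  exact ⟨i, ⟨rightDualIso inferInstance (exactPairingCongrLeft (X := i.obj) (X' := k.objᘁ) (Y := k.obj) e.symm)⟩⟩

/-- The canonical element of the integral: the rescaled mates of dual bases are dual bases. -/
theorem sum_mateDown_comp_mateUp (y : C) (k : Irr C) :
    ∑ i : Irr C, ∑ a, dimLeft i.obj • (mateDown i.objᘁ k.objᘁ ((decomp (y ⊗ i.obj)).proj k a) ≫
      mateUp y i.objᘁ k.objᘁ ((decomp (y ⊗ i.obj)).incl k a)) = dimLeft k.obj • 𝟙 (k.objᘁ ⊗ y) := by
  refine hom_ext_of_irr fun l x => ?_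
  obtain ⟨i, ⟨e⟩⟩ := exists_dual_iso l
  rw [← cancel_epi e.hom, ← Category.assoc, ← Category.assoc]
  -- A test morphism out of a simple object is thus the mate of some `g : k ⟶ y ⊗ i`. Only the
  -- summand of index `i` sees it, and there expanding `g` in the basis `incl` reproduces it.
  obtain ⟨g, hg⟩ := (mateUp (i := i.obj) (k := k.obj) y i.objᘁ k.objᘁ).surjective (e.hom ≫ x)
  rw [← hg, Preadditive.comp_sum, Finset.sum_eq_single i]
  · conv_rhs => rw [(decomp (y ⊗ i.obj)).hom_eq g, mateUp_sum]
    rw [Preadditive.comp_sum, Linear.comp_smul, Category.comp_id, Finset.smul_sum]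
    refine Finset.sum_congr rfl fun a _ => ?_
    rw [Linear.comp_smul, ← Category.assoc, ← scalarOf_smul_id (mateUp y i.objᘁ k.objᘁ g ≫ _),
      Linear.smul_comp, Category.id_comp, smul_smul, smul_smul, mul_comm,
      scalarOf_mateUp_comp_mateDown, mul_comm]
  · intro j _ hj
    rw [Preadditive.comp_sum]
    refine Finset.sum_eq_zero fun a _ => ?_
    rw [Linear.comp_smul, ← Category.assoc,
      dual_hom_eq_zero hj.symm (mateUp y i.objᘁ k.objᘁ g ≫ _), Limits.zero_comp, smul_zero]
  · simp

/-- The weighted sum of the partial traces over the simple objects. -/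
noncomputable def integral {V W : C} (φ : ∀ X : C, V ⊗ X ⟶ W ⊗ X) : V ⟶ W :=
  ∑ i : Irr C, dimLeft i.obj • partialTrace i.objᘁ (φ i.obj)

/-- Invariance of the integral, as for a Haar measure: decompose each `y ⊗ i` into simples `k`, so
that by naturality `φ` is evaluated only at `k`. Exchanging the sums over `i` and `k`, the inner one
becomes a multiple of the identity of `kᘁ ⊗ y`. -/
theorem integral_tensor {V W : C} (φ : ∀ X : C, V ⊗ X ⟶ W ⊗ X)
    (hφ : ∀ {X Y : C} (f : X ⟶ Y), V ◁ f ≫ φ Y = φ X ≫ W ◁ f) (y : C) :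
    integral (fun X => (α_ V y X).hom ≫ φ (y ⊗ X) ≫ (α_ W y X).inv) = integral φ ▷ y := by
  have h (i : Irr C) : φ (y ⊗ i.obj) = ∑ k, ∑ a, V ◁ (decomp (y ⊗ i.obj)).proj k a ≫ φ k.obj ≫
      W ◁ (decomp (y ⊗ i.obj)).incl k a := by
    rw [← Category.id_comp (φ _), ← whiskerLeft_id, ← (decomp (y ⊗ i.obj)).total]
    simp [whiskerLeft_sum, Preadditive.sum_comp, hφ]
  have h₂ (i : Irr C) : dimLeft i.obj • partialTrace i.objᘁ
      ((α_ V y i.obj).hom ≫ φ (y ⊗ i.obj) ≫ (α_ W y i.obj).inv) =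
      ∑ k : Irr C, insertTrace y k.objᘁ (φ k.obj)
        (∑ a, dimLeft i.obj • (mateDown i.objᘁ k.objᘁ ((decomp (y ⊗ i.obj)).proj k a) ≫
          mateUp y i.objᘁ k.objᘁ ((decomp (y ⊗ i.obj)).incl k a))) := by
    rw [h, Preadditive.sum_comp, Preadditive.comp_sum, partialTrace_sum, Finset.smul_sum]
    refine Finset.sum_congr rfl fun k _ => ?_
    rw [Preadditive.sum_comp, Preadditive.comp_sum, partialTrace_sum, Finset.smul_sum,
      insertTrace_sum]
    refine Finset.sum_congr rfl fun a _ => ?_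
    rw [insertTrace_smul, partialTrace_eq_insertTrace (k' := k.objᘁ)]
  simp only [integral, h₂]
  rw [Finset.sum_comm, sum_whiskerRight]
  refine Finset.sum_congr rfl fun k _ => ?_
  rw [← insertTrace_sum (X' := k.objᘁ), sum_mateDown_comp_mateUp, insertTrace_smul, insertTrace_id,
    MonoidalLinear.smul_whiskerRight]

end Integral

/-! ### Traces in braided categories -/

section BraidedTrace

variable {C : Type u} [Category.{v} C] [MonoidalCategory C] [BraidedCategory C]

/-- The trace of an endomorphism, closing its strand with the braiding. -/
def braidedTrace {X : C} (X' : C) [ExactPairing X X'] (f : X ⟶ X) : 𝟙_ C ⟶ 𝟙_ C :=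
  η_ X X' ≫ f ▷ X' ≫ (β_ X X').hom ≫ ε_ X X'

theorem braidedTrace_comm {X Y X' Y' : C} [ExactPairing X X'] [ExactPairing Y Y']
    (f : X ⟶ Y) (g : Y ⟶ X) : braidedTrace X' (f ≫ g) = braidedTrace Y' (g ≫ f) := by
  let : HasRightDual X := ⟨X'⟩
  let : HasRightDual Y := ⟨Y'⟩
  obtain ⟨g', h₁, h₂⟩ : ∃ g' : X' ⟶ Y', η_ X X' ≫ X ◁ g' = η_ Y Y' ≫ g ▷ Y' ∧
      g' ▷ Y ≫ ε_ Y Y' = X' ◁ g ≫ ε_ X X' :=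
    ⟨gᘁ, coevaluation_comp_rightAdjointMate g, rightAdjointMate_comp_evaluation g⟩
  calc
    _ = η_ X X' ≫ f ▷ X' ≫ (g ▷ X' ≫ (β_ X X').hom) ≫ ε_ X X' := by simp [braidedTrace]
    _ = η_ X X' ≫ f ▷ X' ≫ ((β_ Y X').hom ≫ g' ▷ Y) ≫ ε_ Y Y' := by
      rw [BraidedCategory.braiding_naturality_left]; simp [h₂]
    _ = (η_ X X' ≫ X ◁ g') ≫ f ▷ Y' ≫ (β_ Y Y').hom ≫ ε_ Y Y' := by
      rw [← BraidedCategory.braiding_naturality_right]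
      simp [← whisker_exchange_assoc]
    _ = _ := by rw [h₁]; simp [braidedTrace]

theorem braiding_comp_cap {X Y Z : C} (p : X ⊗ Z ⟶ 𝟙_ C) :
    (β_ Y X).hom ▷ Z ≫ (α_ _ _ _).hom ≫ X ◁ (β_ Y Z).hom ≫ (α_ _ _ _).inv ≫ p ▷ Y =
      (α_ _ _ _).hom ≫ Y ◁ p ≫ (ρ_ Y).hom ≫ (λ_ Y).inv := by
  have h := BraidedCategory.braiding_naturality_right Y p
  rw [BraidedCategory.braiding_tensor_right_hom, braiding_tensorUnit_right] at h
  rw [h]; simp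

theorem monodromy_comp_cap (X Y X' Y' : C) [ExactPairing X X'] [ExactPairing Y Y'] :
    monodromy X Y ▷ (Y' ⊗ X') ≫ (β_ (X ⊗ Y) (Y' ⊗ X')).hom ≫ ε_ (X ⊗ Y) (Y' ⊗ X') =
      𝟙 _ ⊗≫ X ◁ ((β_ Y Y').hom ≫ ε_ Y Y') ▷ X' ⊗≫ (β_ X X').hom ≫ ε_ X X' := by
  have hε : ε_ (X ⊗ Y) (Y' ⊗ X') = 𝟙 _ ⊗≫ Y' ◁ (ε_ X X' ▷ Y) ⊗≫ ε_ Y Y' := rfl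
  have hX := braiding_comp_cap (Y := Y) ((β_ X X').hom ≫ ε_ X X')
  have hY := braiding_comp_cap (Y := X) ((β_ Y Y').hom ≫ ε_ Y Y')
  calc
    _ = (β_ X Y).hom ▷ (Y' ⊗ X') ⊗≫ ((β_ Y X).hom ▷ Y' ≫ (β_ (X ⊗ Y) Y').hom) ▷ X' ⊗≫
        Y' ◁ (X ◁ (β_ Y X').hom ≫ (α_ _ _ _).inv ≫ ((β_ X X').hom ≫ ε_ X X') ▷ Y) ⊗≫
          ε_ Y Y' := by
      rw [hε, monodromy, BraidedCategory.braiding_tensor_right_hom (X ⊗ Y),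
        BraidedCategory.braiding_tensor_left_hom X Y X']
      monoidal
    _ = (β_ X Y).hom ▷ (Y' ⊗ X') ⊗≫ (β_ (Y ⊗ X) Y').hom ▷ X' ⊗≫
        Y' ◁ ((β_ Y X).hom ▷ X' ≫ (α_ _ _ _).hom ≫
          X ◁ (β_ Y X').hom ≫ (α_ _ _ _).inv ≫ ((β_ X X').hom ≫ ε_ X X') ▷ Y) ⊗≫ ε_ Y Y' := by
      rw [BraidedCategory.braiding_naturality_left]; monoidal
    _ = (β_ X Y).hom ▷ (Y' ⊗ X') ⊗≫ Y ◁ (β_ X Y').hom ▷ X' ⊗≫ (β_ Y Y').hom ▷ (X ⊗ X') ⊗≫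
        ((Y' ⊗ Y) ◁ ((β_ X X').hom ≫ ε_ X X') ≫ ε_ Y Y' ▷ 𝟙_ C) ⊗≫ 𝟙 _ := by
      rw [hX, BraidedCategory.braiding_tensor_left_hom]; monoidal
    _ = 𝟙 _ ⊗≫ ((β_ X Y).hom ▷ Y' ≫ (α_ _ _ _).hom ≫ Y ◁ (β_ X Y').hom ≫ (α_ _ _ _).inv ≫
          ((β_ Y Y').hom ≫ ε_ Y Y') ▷ X) ▷ X' ⊗≫ ((β_ X X').hom ≫ ε_ X X') := by
      rw [whisker_exchange]; monoidal
    _ = _ := by rw [hY]; monoidal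

/-- Closing `X ⊗ Y` with a single braiding differs from closing `Y` and then `X` by one full twist
of the two strands around each other; the monodromy compensates for it. -/
theorem braidedTrace_comp_monodromy {X Y X' Y' : C} [ExactPairing X X'] [ExactPairing Y Y']
    (f : X ⊗ Y ⟶ X ⊗ Y) :
    letI := BraidedCategory.exactPairing_swap Y Y'
    braidedTrace (Y' ⊗ X') (f ≫ monodromy X Y) = braidedTrace X' (partialTrace Y' f) := by
  have hη : η_ (X ⊗ Y) (Y' ⊗ X') = η_ X X' ⊗≫ (X ◁ η_ Y Y') ▷ X' ⊗≫ 𝟙 _ := rfl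
  let := BraidedCategory.exactPairing_swap Y Y'
  have hε : ε_ Y' Y = (β_ Y Y').hom ≫ ε_ Y Y' := rfl
  simp only [braidedTrace, partialTrace, comp_whiskerRight, Category.assoc, monodromy_comp_cap,
    hη, hε]
  monoidal

end BraidedTrace

/-! ### The global dimension does not vanish -/

/-- With `s = r * r`, the eigenvalues of `M` are `± r`, so its trace is an integer multiple of `r`.
-/
theorem Matrix.conj_trace_of_mul_self {J : Type*} [Fintype J] [DecidableEq J] {s : ℂ} (hs : s ≠ 0)
    {M : Matrix J J ℂ} (hM : M * M = s • 1) :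
    starRingEnd ℂ M.trace = ‖s‖ / s * M.trace := by
  obtain ⟨r, hr⟩ := IsAlgClosed.exists_eq_mul_self s
  have hr0 : r ≠ 0 := by rintro rfl; simp at hr; exact hs hr
  let P : Matrix J J ℂ := (2⁻¹ : ℂ) • (1 + r⁻¹ • M)
  have hP : IsIdempotentElem P := by
    have h2 : (r⁻¹ • M) * (r⁻¹ • M) = 1 := by
      rw [smul_mul_smul_comm, hM, smul_smul, hr]
      field_simp; simp
    simp only [IsIdempotentElem, P]
    rw [smul_mul_smul_comm, add_mul, mul_add, mul_add, h2, one_mul, mul_one, one_mul]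
    module
  have hlin : IsIdempotentElem (Matrix.toLin' P) := hP.map Matrix.toLinAlgEquiv'
  obtain ⟨n, hn⟩ : ∃ n : ℕ, P.trace = n :=
    ⟨_, (Matrix.trace_toLin'_eq P).symm.trans
      (LinearMap.IsIdempotentElem.isProj_range _ hlin).trace⟩
  have ht : M.trace = r * ((2 * n - Fintype.card J : ℝ) : ℂ) := by
    simp only [P, Matrix.trace_smul, Matrix.trace_add, Matrix.trace_one, smul_eq_mul] at hn
    push_cast
    rw [← hn]; field_simp; ring
  rw [ht, map_mul, Complex.conj_ofReal, hr, norm_mul]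
  have : starRingEnd ℂ r * r = ‖r‖ * ‖r‖ := by
    rw [mul_comm, Complex.mul_conj, Complex.normSq_eq_norm_sq]; push_cast; ring
  push_cast
  rw [← this]; field_simp

section GlobalDimension

variable {C : Type u} [Category.{v} C] [Abelian C] [Linear ℂ C] [MonoidalCategory C]
  [MonoidalPreadditive C] [MonoidalLinear ℂ C] [RigidCategory C] [IsFusionCategory C]

section Isotypic

/-- The projection of an object onto its isotypic component of type `k`. -/
noncomputable def isotypicProj (k : Irr C) (X : C) : X ⟶ X :=
  ∑ a, (decomp X).proj k a ≫ (decomp X).incl k a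

theorem comp_isotypicProj {k : Irr C} {X : C} (x : k.obj ⟶ X) : x ≫ isotypicProj k X = x := by
  conv_rhs => rw [(decomp X).hom_eq x]
  rw [isotypicProj, Preadditive.comp_sum]
  refine Finset.sum_congr rfl fun a _ => ?_
  conv_lhs => rw [← Category.assoc, ← scalarOf_smul_id (x ≫ (decomp X).proj k a)]
  simp

theorem comp_isotypicProj_ne {k l : Irr C} (h : l ≠ k) {X : C} (x : l.obj ⟶ X) :
    x ≫ isotypicProj k X = 0 := by
  rw [isotypicProj, Preadditive.comp_sum]
  refine Finset.sum_eq_zero fun a _ => ?_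
  rw [← Category.assoc, (decomp X).comp_proj_zero h, Limits.zero_comp]

theorem isotypicProj_naturality (k : Irr C) {X Y : C} (f : X ⟶ Y) :
    f ≫ isotypicProj k Y = isotypicProj k X ≫ f := by
  refine hom_ext_of_irr fun l x => ?_
  by_cases h : l = k
  · subst h
    rw [← Category.assoc, comp_isotypicProj, ← Category.assoc, comp_isotypicProj]
  · rw [← Category.assoc, comp_isotypicProj_ne h, ← Category.assoc, comp_isotypicProj_ne h,
      Limits.zero_comp]

theorem isotypicProj_obj (k : Irr C) : isotypicProj k k.obj = 𝟙 k.obj := by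
  rw [← comp_isotypicProj (𝟙 k.obj), Category.id_comp]

theorem isotypicProj_obj_ne {k l : Irr C} (h : l ≠ k) : isotypicProj k l.obj = 0 := by
  rw [← Category.id_comp (isotypicProj k l.obj), comp_isotypicProj_ne h]

end Isotypic

theorem partialTrace_id [∀ X : C, ExactPairing Xᘁ X] (V X : C) :
    partialTrace Xᘁ (𝟙 (V ⊗ X)) = dimRight X • 𝟙 V := by
  have h : partialTrace Xᘁ (𝟙 (V ⊗ X)) =
      (ρ_ V).inv ≫ V ◁ (η_ X Xᘁ ≫ ε_ Xᘁ X) ≫ (ρ_ V).hom := by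
    simp [partialTrace]
  rw [h, ← scalarOf_smul_id (η_ X Xᘁ ≫ ε_ Xᘁ X)]
  simp [dimRight]

/-- This is `integral_tensor` for `V = W = 𝟙_ C` and the natural family `isotypicProj k`, whose
integral has a term only at `k`; the rest removes unitors. -/
theorem sum_partialTrace_isotypicProj [∀ X : C, ExactPairing Xᘁ X] (k : Irr C) (y : C) :
    ∑ i : Irr C, dimLeft i.obj • partialTrace i.objᘁ (isotypicProj k (y ⊗ i.obj)) =
      (dimLeft k.obj * dimRight k.obj) • 𝟙 y := by
  have h := integral_tensor (V := 𝟙_ C) (W := 𝟙_ C) (fun X => 𝟙_ C ◁ isotypicProj k X)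
    (fun f => by rw [← whiskerLeft_comp, isotypicProj_naturality, whiskerLeft_comp]) y
  have h₁ : integral (V := 𝟙_ C) (W := 𝟙_ C) (fun X => 𝟙_ C ◁ isotypicProj k X) =
      (dimLeft k.obj * dimRight k.obj) • 𝟙 (𝟙_ C) := by
    rw [integral, Finset.sum_eq_single k]
    · rw [isotypicProj_obj, whiskerLeft_id, partialTrace_id, smul_smul]
    · intro l _ hl
      rw [isotypicProj_obj_ne hl, MonoidalPreadditive.whiskerLeft_zero]
      simp [partialTrace]
    · simp
  have h₂ (i : C) : partialTrace iᘁ ((α_ (𝟙_ C) y i).hom ≫ 𝟙_ C ◁ isotypicProj k (y ⊗ i) ≫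
      (α_ (𝟙_ C) y i).inv) = (λ_ y).hom ≫ partialTrace iᘁ (isotypicProj k (y ⊗ i)) ≫
        (λ_ y).inv := by
    rw [← partialTrace_comp, ← comp_partialTrace]
    congr 1
    monoidal
  rw [h₁] at h
  simp only [integral, h₂] at h
  rw [← cancel_epi (λ_ y).hom, ← cancel_mono (λ_ y).inv]
  simp only [Preadditive.comp_sum, Preadditive.sum_comp, Linear.comp_smul, Linear.smul_comp,
    Category.assoc, h]
  simp

variable [BraidedCategory C]

/-- The pairing `(X', X)` obtained from the pairing `(X, X')` and the braiding. -/
abbrev swapPairing (X : C) : ExactPairing Xᘁ X := BraidedCategory.exactPairing_swap X Xᘁ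

attribute [local instance] swapPairing

theorem scalarOf_braidedTrace {X : C} [Simple X] (f : X ⟶ X) :
    scalarOf (𝟙_ C) (braidedTrace Xᘁ f) = scalarOf X f * dimRight X := by
  rw [← scalarOf_smul_id f]
  have : braidedTrace Xᘁ (scalarOf X f • 𝟙 X) = scalarOf X f • (η_ X Xᘁ ≫ ε_ Xᘁ X) := by
    simp only [braidedTrace, MonoidalLinear.smul_whiskerRight, id_whiskerRight, Linear.smul_comp,
      Linear.comp_smul, Category.id_comp]
    rfl
  rw [this]
  simp [dimRight]

theorem braidedTrace_sum {X X' : C} [ExactPairing X X'] {J : Type*} (s : Finset J)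
    (f : J → (X ⟶ X)) : braidedTrace X' (∑ j ∈ s, f j) = ∑ j ∈ s, braidedTrace X' (f j) := by
  simp [braidedTrace, sum_whiskerRight, Preadditive.comp_sum, Preadditive.sum_comp]

theorem braidedTrace_smul {X X' : C} [ExactPairing X X'] (c : ℂ) (f : X ⟶ X) :
    braidedTrace X' (c • f) = c • braidedTrace X' f := by
  simp [braidedTrace]

/-- The trace of the monodromy on the multiplicity space of `k` in `y ⊗ i`. -/
noncomputable def monodromyTrace (y i k : Irr C) : ℂ :=
  ∑ a, scalarOf k.obj ((decomp (y.obj ⊗ i.obj)).incl k a ≫ monodromy y.obj i.obj ≫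
    (decomp (y.obj ⊗ i.obj)).proj k a)

theorem scalarOf_trace_isotypicProj_monodromy (y i k : Irr C) :
    scalarOf (𝟙_ C) (braidedTrace y.objᘁ (partialTrace i.objᘁ
      (isotypicProj k (y.obj ⊗ i.obj)))) = monodromyTrace y i k * dimRight k.obj := by
  rw [← braidedTrace_comp_monodromy, isotypicProj, Preadditive.sum_comp, braidedTrace_sum,
    map_sum, monodromyTrace, Finset.sum_mul]
  refine Finset.sum_congr rfl fun a _ => ?_
  rw [Category.assoc, braidedTrace_comm (Y' := k.objᘁ), scalarOf_braidedTrace, Category.assoc]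

/-- Take the iterated trace of the identity of `y ⊗ i`, written as the sum of its isotypic
projections. -/
theorem dimRight_mul_dimRight (y i : Irr C) :
    dimRight y.obj * dimRight i.obj = ∑ k, monodromyTrace y i k * dimRight k.obj := by
  have h : ∑ k, isotypicProj k (y.obj ⊗ i.obj) = 𝟙 (y.obj ⊗ i.obj) :=
    (decomp (y.obj ⊗ i.obj)).total
  simp only [← scalarOf_trace_isotypicProj_monodromy]
  rw [← map_sum, ← braidedTrace_sum, ← partialTrace_sum, h, partialTrace_id, braidedTrace_smul,
    map_smul, scalarOf_braidedTrace, scalarOf_id, smul_eq_mul]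
  ring

/-- For fixed `y`, the left dimensions are an eigenvector, with eigenvalue `dimRight y`, of the
transpose of the matrix occurring in `dimRight_mul_dimRight`. -/
theorem dimRight_mul_dimLeft (y k : Irr C) :
    dimRight y.obj * dimLeft k.obj = ∑ i, dimLeft i.obj * monodromyTrace y i k := by
  have h := congrArg (fun f => scalarOf (𝟙_ C) (braidedTrace y.objᘁ f))
    (sum_partialTrace_isotypicProj k y.obj)
  simp only [braidedTrace_sum, braidedTrace_smul, map_sum, map_smul, smul_eq_mul,
    scalarOf_trace_isotypicProj_monodromy, ← mul_assoc, ← Finset.sum_mul] at h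
  rw [scalarOf_braidedTrace, scalarOf_id] at h
  apply mul_right_cancel₀ (dimRight_ne_zero k.obj)
  linear_combination -h

/-- The ratio of the right and the left dimension of a simple object. -/
noncomputable def dimRatio (X : C) : ℂ := dimRight X / dimLeft X

theorem dimRatio_ne_zero (X : C) [Simple X] : dimRatio X ≠ 0 :=
  div_ne_zero (dimRight_ne_zero X) (dimLeft_ne_zero X)

/-- The braiding and its reverse give two evaluations on `X ⊗ Xᘁ`, proportional by simplicity.
Composing with the coevaluation identifies the factor. -/
theorem braiding_comp_evaluation (X : C) [Simple X] :
    (β_ X Xᘁ).hom ≫ ε_ X Xᘁ = dimRatio X • ((β_ Xᘁ X).inv ≫ ε_ X Xᘁ) := by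
  obtain ⟨c, hc⟩ := @eq_smul_evaluation' C _ _ _ _ _ _ _ _ Xᘁ X
    (@BraidedCategory.exactPairing_swap C _ _ (reverseBraiding C) X Xᘁ _) _
    ((β_ X Xᘁ).hom ≫ ε_ X Xᘁ)
  replace hc : (β_ X Xᘁ).hom ≫ ε_ X Xᘁ = c • ((β_ Xᘁ X).inv ≫ ε_ X Xᘁ) := hc
  have h : dimRight X = c * dimLeft X := by
    have h₁ : η_ X Xᘁ ≫ ε_ Xᘁ X = c • (η_ Xᘁ X ≫ ε_ X Xᘁ) := by
      have h₂ : η_ X Xᘁ ≫ ε_ Xᘁ X = η_ X Xᘁ ≫ (β_ X Xᘁ).hom ≫ ε_ X Xᘁ := rfl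
      have h₃ : η_ Xᘁ X ≫ ε_ X Xᘁ = (η_ X Xᘁ ≫ (β_ Xᘁ X).inv) ≫ ε_ X Xᘁ := rfl
      rw [h₂, h₃, hc, Linear.comp_smul, Category.assoc]
    rw [dimRight, h₁, map_smul, smul_eq_mul, dimLeft]
  rw [dimRatio, h, mul_div_cancel_right₀ _ (dimLeft_ne_zero X), hc]

theorem braidedTrace_eq_reverse {X : C} [Simple X] (f : X ⟶ X) :
    braidedTrace Xᘁ f = dimRatio X • @braidedTrace C _ _ (reverseBraiding C) X Xᘁ _ f := by
  have h : @braidedTrace C _ _ (reverseBraiding C) X Xᘁ _ f =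
    η_ X Xᘁ ≫ f ▷ Xᘁ ≫ (β_ Xᘁ X).inv ≫ ε_ X Xᘁ := rfl
  rw [h, braidedTrace, braiding_comp_evaluation, Linear.comp_smul, Linear.comp_smul]

theorem partialTrace_eq_reverse {V W X : C} [Simple X] (φ : V ⊗ X ⟶ W ⊗ X) :
    partialTrace Xᘁ φ = dimRatio X • @partialTrace C _ _ V W X Xᘁ _
      (@BraidedCategory.exactPairing_swap C _ _ (reverseBraiding C) X Xᘁ _) φ := by
  have h : @partialTrace C _ _ V W X Xᘁ _
      (@BraidedCategory.exactPairing_swap C _ _ (reverseBraiding C) X Xᘁ _) φ =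
    (ρ_ V).inv ≫ V ◁ η_ X Xᘁ ≫ (α_ V X Xᘁ).inv ≫ φ ▷ Xᘁ ≫ (α_ W X Xᘁ).hom ≫
      W ◁ ((β_ Xᘁ X).inv ≫ ε_ X Xᘁ) ≫ (ρ_ W).hom := rfl
  have h' : partialTrace Xᘁ φ =
    (ρ_ V).inv ≫ V ◁ η_ X Xᘁ ≫ (α_ V X Xᘁ).inv ≫ φ ▷ Xᘁ ≫ (α_ W X Xᘁ).hom ≫
      W ◁ ((β_ X Xᘁ).hom ≫ ε_ X Xᘁ) ≫ (ρ_ W).hom := rfl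
  rw [h, h', braiding_comp_evaluation]
  simp

theorem reverse_monodromy (X Y : C) :
    @monodromy C _ _ (reverseBraiding C) X Y = inv (monodromy X Y) := by
  have h : @monodromy C _ _ (reverseBraiding C) X Y = (β_ Y X).inv ≫ (β_ X Y).inv := rfl
  rw [h]
  apply IsIso.eq_inv_of_hom_inv_id
  simp [monodromy]

/-- Apply `braidedTrace_comp_monodromy` to `f ≫ g ≫ monodromy y i`, once for each braiding. The
reverse one cancels the monodromy, the other one squares it, and each trace over a simple object
changes by its `dimRatio`. -/
theorem scalarOf_monodromy_sq {y i k : C} [Simple y] [Simple i] [Simple k] (f : y ⊗ i ⟶ k)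
    (g : k ⟶ y ⊗ i) :
    scalarOf k (g ≫ monodromy y i ≫ monodromy y i ≫ f) =
      dimRatio y * dimRatio i / dimRatio k * scalarOf k (g ≫ f) := by
  have h₁ := braidedTrace_comp_monodromy (X' := yᘁ) (Y' := iᘁ) (f ≫ g ≫ monodromy y i)
  have h₂ := @braidedTrace_comp_monodromy C _ _ (reverseBraiding C) y i yᘁ iᘁ _ _
    (f ≫ g ≫ monodromy y i)
  have h₃ : (f ≫ g ≫ monodromy y i) ≫ @monodromy C _ _ (reverseBraiding C) y i = f ≫ g := by
    rw [reverse_monodromy]; simp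
  rw [h₃, @braidedTrace_comm C _ _ (reverseBraiding C) _ _ _ kᘁ] at h₂
  rw [braidedTrace_eq_reverse, partialTrace_eq_reverse] at h₁
  rw [@braidedTrace_smul C _ _ _ _ _ _ _ _ (reverseBraiding C), ← h₂, Category.assoc,
    braidedTrace_comm (Y' := kᘁ)] at h₁
  have h₄ := congrArg (scalarOf (𝟙_ C)) (braidedTrace_eq_reverse (g ≫ f))
  rw [scalarOf_braidedTrace, map_smul, smul_eq_mul] at h₄
  have h₅ := congrArg (scalarOf (𝟙_ C)) h₁
  rw [scalarOf_braidedTrace, map_smul, map_smul, smul_eq_mul, smul_eq_mul] at h₅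
  simp only [Category.assoc] at h₅
  have hk := dimRatio_ne_zero k
  apply mul_right_cancel₀ (dimRight_ne_zero k)
  rw [h₅]
  field_simp
  linear_combination -(dimRatio y * dimRatio i) * h₄

theorem conj_monodromyTrace (y i k : Irr C) :
    starRingEnd ℂ (monodromyTrace y i k) =
      ‖dimRatio y.obj * dimRatio i.obj / dimRatio k.obj‖ /
        (dimRatio y.obj * dimRatio i.obj / dimRatio k.obj) * monodromyTrace y i k := by
  set d := decomp (y.obj ⊗ i.obj) with hd
  set M := monodromy y.obj i.obj with hM
  have h := Matrix.conj_trace_of_mul_self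
    (s := dimRatio y.obj * dimRatio i.obj / dimRatio k.obj)
    (M := Matrix.of fun a b : d.idx k => scalarOf k.obj (d.incl k a ≫ M ≫ d.proj k b))
    (div_ne_zero (mul_ne_zero (dimRatio_ne_zero _) (dimRatio_ne_zero _)) (dimRatio_ne_zero _)) ?_
  · exact h
  · ext a b
    rw [Matrix.mul_apply]
    simp only [Matrix.of_apply]
    have h₁ : d.incl k a ≫ M ≫ M ≫ d.proj k b =
        ∑ c, scalarOf k.obj ((d.incl k a ≫ M) ≫ d.proj k c) • (d.incl k c ≫ M ≫ d.proj k b) := by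
      conv_lhs => rw [← Category.assoc, d.hom_eq (d.incl k a ≫ M)]
      simp [Preadditive.sum_comp]
    have h₂ := scalarOf_monodromy_sq (d.proj k b) (d.incl k a)
    rw [← hM, h₁, map_sum, d.incl_proj] at h₂
    simp only [map_smul, smul_eq_mul, Category.assoc] at h₂
    rw [h₂, Matrix.smul_apply, Matrix.one_apply, smul_eq_mul]
    split_ifs <;> simp

/-- The global dimension of a braided fusion category does not vanish. -/
theorem sum_dimLeft_mul_dimRight_ne_zero :
    ∑ i : Irr C, dimLeft i.obj * dimRight i.obj ≠ 0 := by
  -- The phase is chosen to cancel the one in `conj_monodromyTrace`, so that `x` satisfies the same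
  -- product formula as `dimRight`.
  let x (k : Irr C) : ℂ := starRingEnd ℂ (dimRight k.obj) * dimRatio k.obj / ‖dimRatio k.obj‖
  have hτ (k : Irr C) := dimRatio_ne_zero k.obj
  have hτ' (k : Irr C) : (‖dimRatio k.obj‖ : ℂ) ≠ 0 := by simpa using hτ k
  have hx (y i : Irr C) : x y * x i = ∑ k, monodromyTrace y i k * x k := by
    have h := congrArg (starRingEnd ℂ) (dimRight_mul_dimRight y i)
    simp only [map_mul, map_sum, conj_monodromyTrace] at h
    calc x y * x i = (dimRatio y.obj * dimRatio i.obj / (‖dimRatio y.obj‖ * ‖dimRatio i.obj‖)) *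
          (starRingEnd ℂ (dimRight y.obj) * starRingEnd ℂ (dimRight i.obj)) := by
          simp only [x]; ring
      _ = _ := by
        rw [h, Finset.mul_sum]
        refine Finset.sum_congr rfl fun k _ => ?_
        have := hτ y; have := hτ i; have := hτ k; have := hτ' y; have := hτ' i; have := hτ' k
        simp only [x, norm_mul, norm_div, Complex.ofReal_mul, Complex.ofReal_div]
        field_simp
  have hP : ∑ i : Irr C, dimLeft i.obj * x i ≠ 0 := by
    have h (i : Irr C) : dimLeft i.obj * x i =
        ((‖dimRight i.obj‖ ^ 2 / ‖dimRatio i.obj‖ : ℝ) : ℂ) := by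
      have h₁ : dimLeft i.obj * dimRatio i.obj = dimRight i.obj :=
        mul_div_cancel₀ _ (dimLeft_ne_zero _)
      have h₂ := Complex.mul_conj (dimRight i.obj)
      rw [Complex.normSq_eq_norm_sq] at h₂
      push_cast at h₂ ⊢
      rw [← h₂]
      simp only [x]
      linear_combination (starRingEnd ℂ (dimRight i.obj) / ‖dimRatio i.obj‖) * h₁
    simp only [h]
    rw [← Complex.ofReal_sum, Complex.ofReal_ne_zero]
    obtain ⟨k, -⟩ := Irr.exists_iso (𝟙_ C)
    refine (Finset.sum_pos (fun i _ => ?_) ⟨k, Finset.mem_univ k⟩).ne'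
    have := norm_pos_iff.2 (dimRight_ne_zero i.obj)
    have := norm_pos_iff.2 (hτ i)
    positivity
  -- Pairing the two eigenvectors `x` and `dimLeft` gives two expressions for the same sum, with
  -- eigenvalues `x y` and `dimRight y`. As the pairing is nonzero, these agree.
  have hd (y : Irr C) : x y = dimRight y.obj := by
    apply mul_right_cancel₀ hP
    calc x y * ∑ i : Irr C, dimLeft i.obj * x i
        = ∑ i : Irr C, dimLeft i.obj * (x y * x i) := by
          rw [Finset.mul_sum]; exact Finset.sum_congr rfl fun i _ => by ring
      _ = ∑ k, ∑ i : Irr C, dimLeft i.obj * monodromyTrace y i k * x k := by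
          simp only [hx, Finset.mul_sum]
          rw [Finset.sum_comm]
          simp only [mul_assoc]
      _ = _ := by
          simp only [← Finset.sum_mul, ← dimRight_mul_dimLeft]
          rw [Finset.mul_sum]
          simp only [mul_assoc]
  simpa only [hd] using hP

end GlobalDimension

/-! ### Monoidal automorphisms of the identity are ring operators -/

section Pi2

variable {C : Type u} [Category.{v} C] [Abelian C] [Linear ℂ C] [MonoidalCategory C]
  [BraidedCategory C]

theorem pi2App_naturality (t : Pi2 (BrAut C)) {X Y : C} (f : X ⟶ Y) :
    f ≫ pi2App t Y = pi2App t X ≫ f :=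
  t.hom.iso.hom.naturality f

theorem pi2App_tensor (t : Pi2 (BrAut C)) (X Y : C) :
    pi2App t (X ⊗ Y) = pi2App t X ⊗ₘ pi2App t Y := by
  have h : 𝟙 (X ⊗ Y) ≫ pi2App t (X ⊗ Y) = (pi2App t X ⊗ₘ pi2App t Y) ≫ 𝟙 (X ⊗ Y) :=
    t.hom.isMonoidal.tensor X Y
  simpa using h

theorem pi2App_inv (t : Pi2 (BrAut C)) (X : C) : pi2App t⁻¹ X ≫ pi2App t X = 𝟙 X :=
  congrArg (fun s : Pi2 (BrAut C) => pi2App s X) (mul_inv_cancel t)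

theorem pi2_ext {s t : Pi2 (BrAut C)} (h : ∀ X, pi2App s X = pi2App t X) : s = t :=
  Iso.ext (BrAut.hom_ext h)

theorem pi2App_ringOperator (a : InvObj C) (X : C) :
    pi2App (ringOperator a) X = (ringIso a X).hom := rfl

end Pi2

section RingOperator

variable {C : Type u} [Category.{v} C] [Abelian C] [Linear ℂ C] [MonoidalCategory C]
  [MonoidalPreadditive C] [MonoidalLinear ℂ C] [RigidCategory C] [BraidedCategory C]

theorem monodromy_unit (y : C) : monodromy (𝟙_ C) y = 𝟙 _ := by simp [monodromy]

/-! ### Averaging the monodromy against a monoidal automorphism of the identity -/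

section Average

attribute [local instance] swapPairing

variable [IsFusionCategory C]

/-- Evaluate the integral of the integrand at `y ⊗ X` twice. Invariance gives the right side; the
hexagon identities and monoidality of `u` pull the strand `y` out of the partial trace, which gives
the left side. -/
theorem integral_monodromy (u : ∀ X : C, X ⟶ X) (hu : ∀ {X Y : C} (f : X ⟶ Y), f ≫ u Y = u X ≫ f)
    (hut : ∀ X Y : C, u (X ⊗ Y) = u X ⊗ₘ u Y) (c y : C) :
    (monodromy c y ≫ c ◁ u y) ≫ integral (fun X => monodromy c X ≫ c ◁ u X) ▷ y =
      integral (fun X => monodromy c X ≫ c ◁ u X) ▷ y := by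
  set φ : ∀ X : C, c ⊗ X ⟶ c ⊗ X := fun X => monodromy c X ≫ c ◁ u X with hφ
  have h := integral_tensor φ (fun f => by
    simp only [hφ]
    rw [← Category.assoc, monodromy_naturality_right, Category.assoc, Category.assoc,
      ← whiskerLeft_comp, ← whiskerLeft_comp, hu]) y
  have h₁ (X : C) : (α_ c y X).hom ≫ φ (y ⊗ X) ≫ (α_ c y X).inv =
      (β_ c y).hom ▷ X ≫ ((α_ y c X).hom ≫ y ◁ φ X ≫ (α_ y c X).inv) ≫
        ((β_ y c).hom ≫ c ◁ u y) ▷ X := by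
    calc
      _ = (β_ c y).hom ▷ X ≫ (α_ y c X).hom ≫ y ◁ monodromy c X ⊗≫
          ((β_ y c).hom ≫ c ◁ u y) ▷ X ≫ (c ⊗ y) ◁ u X := by
        simp only [hφ]
        rw [hut, MonoidalCategory.tensorHom_def, monodromy_tensor_right]; monoidal
      _ = _ := by
        rw [← whisker_exchange]; simp only [hφ]; monoidal
  have h₂ (X : C) : partialTrace Xᘁ ((α_ c y X).hom ≫ φ (y ⊗ X) ≫ (α_ c y X).inv) =
      (β_ c y).hom ≫ y ◁ partialTrace Xᘁ (φ X) ≫ (β_ y c).hom ≫ c ◁ u y := by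
    rw [h₁, comp_partialTrace, partialTrace_comp, ← whiskerLeft_partialTrace]
  have h₃ : integral (fun X => (α_ c y X).hom ≫ φ (y ⊗ X) ≫ (α_ c y X).inv) =
      (β_ c y).hom ≫ y ◁ integral φ ≫ (β_ y c).hom ≫ c ◁ u y := by
    simp only [integral, h₂, whiskerLeft_sum, MonoidalLinear.whiskerLeft_smul,
      Preadditive.comp_sum, Preadditive.sum_comp, Linear.comp_smul, Linear.smul_comp]
  refine Eq.trans ?_ h
  rw [h₃, BraidedCategory.braiding_naturality_right_assoc, ← whisker_exchange]
  simp [monodromy]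

theorem integral_monodromy_eq_zero_or (t u : ∀ X : C, X ⟶ X) (htu : ∀ X, u X ≫ t X = 𝟙 X)
    (hu : ∀ {X Y : C} (f : X ⟶ Y), f ≫ u Y = u X ≫ f)
    (hut : ∀ X Y : C, u (X ⊗ Y) = u X ⊗ₘ u Y) (c : C) [Simple c] :
    integral (fun X => monodromy c X ≫ c ◁ u X) = 0 ∨ ∀ y, monodromy c y = c ◁ t y := by
  refine or_iff_not_imp_left.2 fun h y => ?_
  have h₁ := integral_monodromy u hu hut c y
  have : IsIso (integral (fun X => monodromy c X ≫ c ◁ u X)) := isIso_of_hom_simple h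
  rw [← Category.id_comp (integral (fun X => monodromy c X ≫ c ◁ u X) ▷ y), ← Category.assoc,
    cancel_mono, Category.comp_id] at h₁
  rw [← Category.comp_id (monodromy c y), ← whiskerLeft_id, ← htu, whiskerLeft_comp,
    reassoc_of% h₁]

/-- Both sides are traces of squared monodromies, which agree after moving one braiding around by
cyclicity. This is the symmetry of the `S`-matrix. -/
theorem trace_partialTrace_monodromy_comm (c i : C) :
    braidedTrace cᘁ (partialTrace iᘁ (monodromy c i)) =
      braidedTrace iᘁ (partialTrace cᘁ (monodromy i c)) := by
  rw [← braidedTrace_comp_monodromy, ← braidedTrace_comp_monodromy]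
  have h : monodromy c i ≫ monodromy c i =
      (β_ c i).hom ≫ ((β_ i c).hom ≫ (β_ c i).hom ≫ (β_ i c).hom) := by simp [monodromy]
  have h' : monodromy i c ≫ monodromy i c =
      ((β_ i c).hom ≫ (β_ c i).hom ≫ (β_ i c).hom) ≫ (β_ c i).hom := by simp [monodromy]
  rw [h, h', braidedTrace_comm (X' := iᘁ ⊗ cᘁ) (Y' := cᘁ ⊗ iᘁ)]

theorem exists_irr_monodromy_eq [IsNondegenerate C] (t u : ∀ X : C, X ⟶ X)
    (htu : ∀ X, u X ≫ t X = 𝟙 X)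
    (hu : ∀ {X Y : C} (f : X ⟶ Y), f ≫ u Y = u X ≫ f)
    (hut : ∀ X Y : C, u (X ⊗ Y) = u X ⊗ₘ u Y) :
    ∃ c : Irr C, ∀ y, monodromy c.obj y = c.obj ◁ t y := by
  by_contra! H
  have hN (c : Irr C) : integral (fun X => monodromy c.obj X ≫ c.obj ◁ u X) = 0 :=
    (integral_monodromy_eq_zero_or t u htu hu hut c.obj).resolve_right
      fun h => (H c).elim fun y hy => hy (h y)
  let w (i : Irr C) : ℂ := scalarOf i.obj (u i.obj)
  have hw (c i : Irr C) : monodromy c.obj i.obj ≫ c.obj ◁ u i.obj =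
      w i • monodromy c.obj i.obj := by
    rw [← scalarOf_smul_id (u i.obj)]; simp [w]
  let σ (c i : Irr C) : ℂ :=
    scalarOf (𝟙_ C) (braidedTrace c.objᘁ (partialTrace i.objᘁ (monodromy c.obj i.obj)))
  have hσ (c i : Irr C) : σ c i = σ i c :=
    congrArg (scalarOf (𝟙_ C)) (trace_partialTrace_monodromy_comm c.obj i.obj)
  have h₁ (c : Irr C) : ∑ i : Irr C, dimLeft i.obj * w i * σ c i = 0 := by
    have h := congrArg (fun f => scalarOf (𝟙_ C) (braidedTrace c.objᘁ f)) (hN c)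
    simp only [integral, hw, partialTrace_smul, smul_smul, braidedTrace_sum, braidedTrace_smul,
      map_sum, map_smul, smul_eq_mul] at h
    refine h.trans ?_
    simp [braidedTrace]
  obtain ⟨o, ⟨e⟩⟩ := Irr.exists_iso (𝟙_ C)
  -- The dichotomy for `t = u = id`: its second alternative would make `i` transparent to
  -- everything, hence the unit.
  have h₂ (i : Irr C) (hi : i ≠ o) : ∑ c : Irr C, dimLeft c.obj * σ i c = 0 := by
    have h := (integral_monodromy_eq_zero_or (fun X => 𝟙 X) (fun X => 𝟙 X) (by simp) (by simp)
      (by simp) i.obj).resolve_right fun h => hi (by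
        obtain ⟨e'⟩ := IsNondegenerate.iso_unit i.obj inferInstance fun Y => (h Y).trans (by simp)
        exact Irr.eq_of_iso (e' ≪≫ e))
    replace h := congrArg (fun f => scalarOf (𝟙_ C) (braidedTrace i.objᘁ f)) h
    simp only [integral, whiskerLeft_id, Category.comp_id, braidedTrace_sum, braidedTrace_smul,
      map_sum, map_smul, smul_eq_mul] at h
    refine h.trans ?_
    simp [braidedTrace]
  have h₃ : ∑ c : Irr C, dimLeft c.obj * σ o c =
      (∑ c : Irr C, dimLeft c.obj * dimRight c.obj) * dimRight o.obj := by
    rw [Finset.sum_mul]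
    refine Finset.sum_congr rfl fun c _ => ?_
    have h : monodromy o.obj c.obj = 𝟙 _ := Transparent.of_iso e (monodromy_unit c.obj)
    simp only [σ, h, partialTrace_id, braidedTrace_smul, map_smul, smul_eq_mul]
    rw [scalarOf_braidedTrace, scalarOf_id]; ring
  -- Summed over `i` first this vanishes by `h₁` and the symmetry of `σ`; summed over `c` first only
  -- `i = o` survives, with the global dimension as a factor.
  have h₄ : ∑ i : Irr C, dimLeft i.obj * w i * ∑ c : Irr C, dimLeft c.obj * σ i c = 0 := by
    calc _ = ∑ c : Irr C, dimLeft c.obj * ∑ i : Irr C, dimLeft i.obj * w i * σ c i := by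
          simp only [Finset.mul_sum]
          rw [Finset.sum_comm]
          refine Finset.sum_congr rfl fun c _ => Finset.sum_congr rfl fun i _ => ?_
          rw [hσ i c]; ring
      _ = 0 := by simp [h₁]
  rw [Finset.sum_eq_single o (fun i _ hi => by rw [h₂ i hi, mul_zero]) (by simp), h₃] at h₄
  have hwo : w o ≠ 0 := by
    intro h
    have := htu o.obj
    rw [← scalarOf_smul_id (u o.obj), show scalarOf o.obj (u o.obj) = 0 from h, zero_smul,
      Limits.zero_comp] at this
    exact id_nonzero _ this.symm
  exact mul_ne_zero (mul_ne_zero (dimLeft_ne_zero _) hwo)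
    (mul_ne_zero sum_dimLeft_mul_dimRight_ne_zero (dimRight_ne_zero _)) h₄

end Average

/-- Since `c` contributes only `t y`, the monodromy of `c ⊗ c'` is `c ◁ (monodromy c' y ≫ c' ◁ t
y)`. Naturality along the coevaluation shows that the inner map has the same adjunct as the
identity. -/
theorem transparent_tensor_dual {c c' : C} [ExactPairing c c'] (t : ∀ X : C, X ⟶ X)
    (h : ∀ y, monodromy c y = c ◁ t y) (y : C) : Transparent (c ⊗ c') y := by
  have h₁ : monodromy (c ⊗ c') y =
      (α_ c c' y).hom ≫ c ◁ (monodromy c' y ≫ c' ◁ t y) ≫ (α_ c c' y).inv := by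
    calc
      _ = (α_ c c' y).hom ≫ c ◁ ((β_ c' y).hom ≫ t y ▷ c' ≫ (β_ y c').hom) ≫ (α_ c c' y).inv := by
        rw [monodromy_tensor_left, h]; monoidal
      _ = _ := by rw [BraidedCategory.braiding_naturality_left]; simp [monodromy]
  have h₂ : monodromy c' y ≫ c' ◁ t y = 𝟙 (c' ⊗ y) := by
    have h₃ := monodromy_naturality_left (η_ c c') y
    rw [h₁, monodromy_unit, Category.id_comp] at h₃
    apply (tensorLeftHomEquiv y c c' (c' ⊗ y)).injective
    change (λ_ _).inv ≫ η_ c c' ▷ _ ≫ (α_ _ _ _).hom ≫ c ◁ (monodromy c' y ≫ c' ◁ t y) =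
      (λ_ _).inv ≫ η_ c c' ▷ _ ≫ (α_ _ _ _).hom ≫ c ◁ (𝟙 (c' ⊗ y))
    rw [cancel_epi, ← cancel_mono (α_ c c' y).inv]
    simpa using h₃
  rw [Transparent, h₁, h₂]; simp

variable [IsFusionCategory C]

theorem eq_smul_coevaluation {X X' : C} [ExactPairing X X'] [Simple X] (a : 𝟙_ C ⟶ X ⊗ X') :
    ∃ c : ℂ, a = c • η_ X X' := by
  obtain ⟨f, rfl⟩ := (tensorRightHomEquiv (𝟙_ C) X X' X).surjective a
  refine ⟨scalarOf X ((λ_ X).inv ≫ f), ?_⟩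
  have hf : f = scalarOf X ((λ_ X).inv ≫ f) • (λ_ X).hom := by
    rw [← cancel_epi (λ_ X).inv, Linear.comp_smul, Iso.inv_hom_id, scalarOf_smul_id]
  conv_lhs => rw [hf]
  simp [tensorRightHomEquiv, unitors_equal]

/-- Every simple summand of `c ⊗ c'` is transparent, hence the unit, and the unit occurs only once
because maps from it are multiples of the coevaluation. -/
theorem tensor_dual_iso_unit [IsNondegenerate C] {c c' : C} [ExactPairing c c'] [Simple c]
    (h : ∀ y, Transparent (c ⊗ c') y) : Nonempty (c ⊗ c' ≅ 𝟙_ C) := by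
  obtain ⟨r, hr⟩ := exists_retraction (coevaluation_ne_zero (X := c) (X' := c'))
  refine ⟨⟨r, η_ c c', hom_ext_of_irr fun k x => ?_, hr⟩⟩
  by_cases hx : x = 0
  · simp [hx]
  obtain ⟨s, hs⟩ := exists_retraction hx
  obtain ⟨e⟩ := IsNondegenerate.iso_unit k.obj inferInstance fun y => by
    have h₁ := monodromy_naturality_left x y =≫ s ▷ y
    rw [show monodromy (c ⊗ c') y = 𝟙 _ from h y, Category.comp_id, Category.assoc,
      ← comp_whiskerRight, hs, id_whiskerRight, Category.comp_id] at h₁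
    exact h₁.symm
  obtain ⟨z, hz⟩ := eq_smul_coevaluation (e.inv ≫ x)
  rw [← cancel_epi e.inv, ← Category.assoc, hz]
  simp [reassoc_of% hr, hz]

theorem ringOperator_surjective [IsNondegenerate C] :
    Function.Surjective (ringOperator : InvObj C →* Pi2 (BrAut C)) := by
  intro t
  obtain ⟨c, hc⟩ := exists_irr_monodromy_eq (pi2App t) (pi2App t⁻¹) (pi2App_inv t)
    (pi2App_naturality t⁻¹) (pi2App_tensor t⁻¹)
  obtain ⟨e⟩ := tensor_dual_iso_unit (c := c.obj) (c' := c.objᘁ)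
    (transparent_tensor_dual (pi2App t) hc)
  let a : InvObj C :=
    { val := toSkeleton c.obj
      inv := toSkeleton c.objᘁ
      val_inv := by
        rw [← Skeleton.toSkeleton_tensorObj, Skeleton.one_eq]; exact congr_toSkeleton_of_iso e
      inv_val := by
        rw [← Skeleton.toSkeleton_tensorObj, Skeleton.one_eq]
        exact congr_toSkeleton_of_iso (β_ _ _ ≪≫ e) }
  exact ⟨a, pi2_ext fun X => (eq_ringIso a (x := c.obj) rfl (hc X).symm).symm⟩

theorem ringOperator_injective [IsNondegenerate C] :
    Function.Injective (ringOperator : InvObj C →* Pi2 (BrAut C)) := by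
  rw [injective_iff_map_eq_one]
  intro a ha
  have hs : Simple a.obj := by
    have := a.isEquivalence_tensorLeft
    have : Simple (a.obj ⊗ 𝟙_ C) := simple_obj (tensorLeft a.obj) (𝟙_ C)
    exact Simple.of_iso (ρ_ a.obj).symm
  obtain ⟨e⟩ := IsNondegenerate.iso_unit a.obj hs fun Y =>
    (transparent_iff_ringIso a a.toSkeleton_obj Y).2
      (congrArg (fun s : Pi2 (BrAut C) => pi2App s Y) ha)
  exact Units.ext (a.toSkeleton_obj.symm.trans (congr_toSkeleton_of_iso e))

end RingOperator

/-! ### Exactness -/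

section Exactness

variable {C : Type u} [Category.{v} C] [Abelian C] [Linear ℂ C] [MonoidalCategory C]
  [BraidedCategory C] (A : Mon C)

theorem mem_transparentSubgroup_iff {a : InvObj C} {c : C} :
    a ∈ transparentSubgroup c ↔ (ringIso a c).hom = 𝟙 c :=
  ⟨fun h => (transparent_iff_ringIso a a.toSkeleton_obj c).1 (h _ a.toSkeleton_obj),
    fun h _ hx => (transparent_iff_ringIso a hx c).2 h⟩

theorem sigma_eq_one_iff {a : InvObj C} : sigma A a = 1 ↔ a ∈ transparentSubgroup A.X := by
  rw [mem_transparentSubgroup_iff]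
  exact ⟨fun h => congrArg (fun l : Aut A => l.hom.hom) h, fun h => Iso.ext (Mon.Hom.ext h)⟩

variable {A}

theorem pi2App_map_forget (t : Pi2 (BrAutOver A)) (X : C) :
    pi2App (Pi2.map (BrAutOver.forget A) t) X = t.hom.toHom.iso.hom.app X := by
  have h := Iso.conjAut_apply (Functor.Monoidal.εIso (BrAutOver.forget A)).symm
    ((BrAutOver.forget A).mapAut (𝟙_ (BrAutOver A)) t)
  exact (congrArg (fun s : Pi2 (BrAut C) => pi2App s X) h).trans
    ((Category.id_comp _).trans (Category.comp_id _))

theorem pi2Over_app (t : Pi2 (BrAutOver A)) : t.hom.toHom.iso.hom.app A.X = 𝟙 A.X := by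
  have h := t.hom.comm
  have h₁ : (𝟙_ (BrAutOver A)).lam = 𝟙 A.X := BrAutOver.ofAut_lam 1
  rw [h₁] at h
  exact (Category.comp_id _).symm.trans h

theorem map_forget_injective : Function.Injective (Pi2.map (BrAutOver.forget A)) := by
  intro s t h
  refine Iso.ext (BrAutOver.Hom.ext (BrAut.hom_ext fun X => ?_))
  rw [← pi2App_map_forget, ← pi2App_map_forget, h]

theorem exists_map_forget {t : Pi2 (BrAut C)} (ht : pi2App t A.X = 𝟙 A.X) :
    ∃ s : Pi2 (BrAutOver A), Pi2.map (BrAutOver.forget A) s = t := by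
  have h₁ : (𝟙_ (BrAutOver A)).lam = 𝟙 A.X := BrAutOver.ofAut_lam 1
  have h : t.hom.iso.hom.app A.X ≫ (𝟙_ (BrAutOver A)).lam = (𝟙_ (BrAutOver A)).lam := by
    rw [h₁]; exact (Category.comp_id _).trans ht
  refine ⟨BrAutOver.isoOfHom ⟨t.hom, h⟩, pi2_ext fun X => pi2App_map_forget _ X⟩

/-- If the ring operators are all of `π₂`, then those that are trivial on `A` form `π₂` of the
categorical group over `A`. -/
theorem exists_pi2Over_equiv (h : Function.Bijective (ringOperator : InvObj C →* Pi2 (BrAut C))) :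
    ∃ e : Pi2 (BrAutOver A) ≃* transparentSubgroup A.X, ∀ t : Pi2 (BrAutOver A),
      ringOperator (e t : InvObj C) = Pi2.map (BrAutOver.forget A) t := by
  let E := MulEquiv.ofBijective _ h
  have hE (t : Pi2 (BrAut C)) : ringOperator (E.symm t) = t := E.apply_symm_apply t
  have hmem (t : Pi2 (BrAutOver A)) :
      E.symm (Pi2.map (BrAutOver.forget A) t) ∈ transparentSubgroup A.X := by
    rw [mem_transparentSubgroup_iff, ← pi2App_ringOperator, hE, pi2App_map_forget, pi2Over_app]
  let Φ : Pi2 (BrAutOver A) →* transparentSubgroup A.X :=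
    (E.symm.toMonoidHom.comp (Pi2.map (BrAutOver.forget A))).codRestrict _ hmem
  have hΦ : Function.Bijective Φ := by
    constructor
    · intro s t hst
      exact map_forget_injective (E.symm.injective (congrArg Subtype.val hst))
    · rintro ⟨a, ha⟩
      obtain ⟨s, hs⟩ := exists_map_forget (A := A) (t := ringOperator a)
        (mem_transparentSubgroup_iff.1 ha)
      exact ⟨s, Subtype.ext ((congrArg E.symm hs).trans (E.symm_apply_apply a))⟩
  exact ⟨MulEquiv.ofBijective Φ hΦ, fun t => hE _⟩

/-- The compatibility of a 2-morphism from `ofAut l` to the unit says exactly that its component at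
`A` is `l`. -/
theorem autToPi1_eq_one_iff {l : Aut A} : autToPi1 A l = 1 ↔ l ∈ (evalAt A).range := by
  have h₁ : (𝟙_ (BrAutOver A)).lam = 𝟙 A.X := BrAutOver.ofAut_lam 1
  constructor
  · intro h
    obtain e : BrAutOver.ofAut l ≅ 𝟙_ (BrAutOver A) := Skeleton.isoOfEq h
    refine ⟨BrAut.isoOfHom e.hom.toHom, Iso.ext (Mon.Hom.ext ?_)⟩
    have h := e.hom.comm
    rw [h₁, BrAutOver.ofAut_lam] at h
    exact (Category.comp_id _).symm.trans h
  · rintro ⟨t, rfl⟩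
    refine congr_toSkeleton_of_iso (BrAutOver.isoOfHom (F := BrAutOver.ofAut (evalAt A t))
      (G := 𝟙_ (BrAutOver A)) ⟨t.hom, ?_⟩)
    rw [h₁, BrAutOver.ofAut_lam]
    exact Category.comp_id _

theorem map_toStab_eq_one_iff {x : Pi1 (BrAutOver A)} :
    Pi1.map (toStab A) x = 1 ↔ x ∈ (autToPi1 A).range := by
  constructor
  · intro h
    induction x using Quotient.inductionOn with
    | h F =>
    change Pi1.map (toStab A) (toSkeleton F) = toSkeleton (𝟙_ (Stab A)) at h
    rw [Pi1.map_toSkeleton] at h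
    have e : (toStab A).obj F ≅ 𝟙_ (Stab A) := Skeleton.isoOfEq h
    let f : 𝟙_ (BrAut C) ⟶ F.aut := e.inv.hom
    -- The automorphism `λ ∘ f_A` is the one for which `f` becomes a 2-morphism from `(id, l)` to
    -- `F`.
    let l : Aut A := Functor.mapMonIdIso.symm.app A ≪≫ (Functor.mapMonNatIso f.iso).app A ≪≫ F.algIso
    have hl : l.hom.hom = f.iso.hom.app A.X ≫ F.lam := Category.id_comp _
    refine ⟨l, congr_toSkeleton_of_iso (BrAutOver.isoOfHom (F := BrAutOver.ofAut l) (G := F)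
      ⟨f, ?_⟩)⟩
    rw [BrAutOver.ofAut_lam, hl]
    rfl
  · rintro ⟨l, rfl⟩
    change Pi1.map (toStab A) (toSkeleton (BrAutOver.ofAut l)) = toSkeleton (𝟙_ (Stab A))
    rw [Pi1.map_toSkeleton]
    rfl

theorem map_toStab_surjective : Function.Surjective (Pi1.map (toStab A)) := by
  intro x
  induction x using Quotient.inductionOn with
  | h F =>
  obtain ⟨F, ⟨f⟩⟩ := F
  exact ⟨toSkeleton (⟨F, f⟩ : BrAutOver A), Pi1.map_toSkeleton _ _⟩

end Exactness

theorem mainTheorem6 {C : Type u} [Category.{v} C] [Abelian C] [Linear ℂ C] [MonoidalCategory C]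
    [MonoidalPreadditive C] [MonoidalLinear ℂ C] [RigidCategory C] [BraidedCategory C]
    [IsFusionCategory C] [IsNondegenerate C] (A : Mon C) [IsConnectedEtale A] :
    -- the ring operators give an isomorphism of `Inv(C)` with `π₂` of the categorical group of
    -- braided autoequivalences, under which `π₂` of the one over `A` is `A' ∩ Inv(C)`
    Function.Bijective (ringOperator : InvObj C →* Pi2 (BrAut C)) ∧
    (∃ e : Pi2 (BrAutOver A) ≃* transparentSubgroup A.X,
      ∀ t : Pi2 (BrAutOver A),
        ringOperator (e t : InvObj C) = Pi2.map (BrAutOver.forget A) t) ∧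
    -- the exact sequence of groups
    Function.Injective (transparentSubgroup A.X).subtype ∧
    Function.MulExact (transparentSubgroup A.X).subtype (sigma A) ∧
    Function.MulExact (sigma A) (autToPi1 A) ∧
    Function.MulExact (autToPi1 A) (Pi1.map (toStab A)) ∧
    Function.Surjective (Pi1.map (toStab A)) := by
  have hσ : Function.Bijective (ringOperator : InvObj C →* Pi2 (BrAut C)) :=
    ⟨ringOperator_injective, ringOperator_surjective⟩
  refine ⟨hσ, exists_pi2Over_equiv hσ, Subgroup.subtype_injective _, fun a => ?_, fun l => ?_,
    fun x => map_toStab_eq_one_iff, map_toStab_surjective⟩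
  · rw [sigma_eq_one_iff]; simp
  -- The kernel is the image of all of `π₂` under `evalAt`; surjectivity of the ring operators
  -- identifies it with the image of `sigma`.
  · rw [autToPi1_eq_one_iff]
    constructor
    · rintro ⟨t, rfl⟩
      obtain ⟨a, rfl⟩ := hσ.2 t
      exact ⟨a, rfl⟩
    · rintro ⟨a, rfl⟩
      exact ⟨ringOperator a, rfl⟩
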